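/- Let $\mathbb K=\mathbb R$ or $\mathbb C$ and let $M$ be a (smooth real, respectively complex) manifold of dimension $3$ over $\mathbb K$; all functions, forms and bi-vectors are smooth (holomorphic if $\mathbb K=\mathbb C$). Let $\Lambda,\Lambda_1$ be Poisson structures on $M$, that is, bi-vector fields whose brackets $\{f,g\}=\Lambda(df,dg)$, $\{f,g\}_1=\Lambda_1(df,dg)$ satisfy the Jacobi identity for all locally defined functions. Assume that the couple $(\Lambda,\Lambda_1)$ is generic at each point, i.e. $(a\Lambda+b\Lambda_1)(p)\neq 0$ for all $p\in M$ and all $(a,b)\in\mathbb C^2\setminus\{(0,0)\}$. Let $(\omega,\omega_1,\Omega)$ represent $(\Lambda,\Lambda_1)$: $\omega,\omega_1$ are $1$-forms and $\Omega$ is a nowhere vanishing $3$-form on $M$ such that $$\alpha\wedge\beta\wedge\omega=\Lambda(\alpha,\beta)\,\Omega,\qquad \alpha\wedge\beta\wedge\omega_1=\Lambda_1(\alpha,\beta)\,\Omega$$ for every $p\in M$ and all $\alpha,\beta\in T_p^*M$. Then there exists a $1$-form $\lambda$ on $M$ with $d\omega=\lambda\wedge\omega$ and $d\omega_1=\lambda\wedge\omega_1$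 if and only if $(\Lambda,\Lambda_1)$ is a Poisson pair, i.e. each point of $M$ has an open neighborhood on which $\Lambda$, $\Lambda_1$ and $\Lambda+\Lambda_1$ are Poisson. Moreover, for every such $\lambda$: 1. $\operatorname{Im}\Lambda(p)\cap\operatorname{Im}\Lambda_1(p)\subset\operatorname{Ker} d\lambda(p)$ for every $p\in M$, where $\operatorname{Im}\Lambda(p)=\{\Lambda(\alpha,\cdot):\alpha\in T_p^*M\}\subset T_pM$ and $\operatorname{Ker}d\lambda(p)=\{v\in T_pM: d\lambda(v,w)=0\ \text{for all}\ w\in T_pM\}$; 2. $d\lambda=0$ on $M$ if and only if $(\Lambda,\Lambda_1)$ is flat, i.e. around each point of $M$ there are coordinates in which both $\Lambda$ and $\Lambda_1$ have constant coefficients. -/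

import Mathlib

open scoped Manifold ContDiff

noncomputable section

namespace BiHam

section Fields

variable (𝕜 : Type*) [RCLike 𝕜] (E : Type*) [NormedAddCommGroup E] [NormedSpace 𝕜 E]
  (M : Type*) [TopologicalSpace M] [ChartedSpace E M]

/-- Differential `k`-forms on `M`, not necessarily smooth: an alternating `k`-linear form
on each tangent space. -/
abbrev DiffForm (k : ℕ) : Type _ :=
  (p : M) → TangentSpace 𝓘(𝕜, E) p [⋀^Fin k]→L[𝕜] 𝕜

/-- Bi-vector fields on `M`, not necessarily smooth: an element of `Λ² (T_p M)`, regarded as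
an alternating bilinear form on the cotangent space, for each point `p`. -/
abbrev BivectorField : Type _ :=
  (p : M) → (TangentSpace 𝓘(𝕜, E) p →L[𝕜] 𝕜) [⋀^Fin 2]→L[𝕜] 𝕜

end Fields

variable {𝕜 : Type*} [RCLike 𝕜] {E : Type*} [NormedAddCommGroup E] [NormedSpace 𝕜 E]
  {M : Type*} [TopologicalSpace M] [ChartedSpace E M]

/-! ### Differential forms -/

/-- The exterior product `α ∧ η` of a covector `α` and a `k`-form `η` at `p`:
`(α ∧ η) (v₀, …, v_k) = ∑ i, (-1) ^ i * α v_i * η (v₀, …, v_k without v_i)`. -/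
def wedge {p : M} {k : ℕ} (α : TangentSpace 𝓘(𝕜, E) p →L[𝕜] 𝕜)
    (η : TangentSpace 𝓘(𝕜, E) p [⋀^Fin k]→L[𝕜] 𝕜) :
    TangentSpace 𝓘(𝕜, E) p [⋀^Fin (k + 1)]→L[𝕜] 𝕜 :=
  ContinuousAlternatingMap.alternatizeUncurryFin (𝕜 := 𝕜) (E := E) (F := 𝕜)
    (ContinuousLinearMap.smulRight (M₁ := E) (M₂ := E [⋀^Fin k]→L[𝕜] 𝕜) α η)

namespace DiffForm

/-- A `1`-form at `p` as a covector. -/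
def covector (lam : DiffForm 𝕜 E M 1) (p : M) : TangentSpace 𝓘(𝕜, E) p →L[𝕜] 𝕜 :=
  (ContinuousAlternatingMap.ofSubsingleton 𝕜 (TangentSpace 𝓘(𝕜, E) p) 𝕜 (0 : Fin 1)).symm (lam p)

/-- The expression of a form in a chart `e`: its pullback by `e⁻¹`. Meaningful on `e.target`. -/
def inChart {k : ℕ} (η : DiffForm 𝕜 E M k) (e : OpenPartialHomeomorph M E) (y : E) :
    E [⋀^Fin k]→L[𝕜] 𝕜 :=
  (η (e.symm y)).compContinuousLinearMap (mfderiv 𝓘(𝕜, E) 𝓘(𝕜, E) e.symm y)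

/-- A form is smooth (holomorphic if `𝕜 = ℂ`) if it is so in all charts. -/
def IsSmooth {k : ℕ} (η : DiffForm 𝕜 E M k) : Prop :=
  ∀ e ∈ atlas E M, ContDiffOn 𝕜 ∞ (η.inChart e) e.target

/-- Exterior derivative: at `p` it is computed in the chart at `p`. -/
def d {k : ℕ} (η : DiffForm 𝕜 E M k) : DiffForm 𝕜 E M (k + 1) := fun p =>
  (extDeriv (η.inChart (chartAt E p)) (chartAt E p p)).compContinuousLinearMap
    (mfderiv 𝓘(𝕜, E) 𝓘(𝕜, E) (chartAt E p) p)

/-- The kernel of a `2`-form at `p`. -/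
def ker (η : DiffForm 𝕜 E M 2) (p : M) : Set (TangentSpace 𝓘(𝕜, E) p) :=
  {v | ∀ w : TangentSpace 𝓘(𝕜, E) p, η p ![v, w] = 0}

end DiffForm

/-! ### Bi-vectors and Poisson structures -/

/-- The differential at `p` of a scalar function. -/
def diff (f : M → 𝕜) (p : M) : TangentSpace 𝓘(𝕜, E) p →L[𝕜] 𝕜 :=
  mfderiv 𝓘(𝕜, E) 𝓘(𝕜, 𝕜) f p

namespace BivectorField

/-- The expression of a bi-vector field in a chart `e`: its push-forward by `e`, whose values on
covectors of `E` are obtained by pulling these back by `e`. Meaningful on `e.target`. -/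
def inChart (Λ : BivectorField 𝕜 E M) (e : OpenPartialHomeomorph M E) (y : E) :
    (E →L[𝕜] 𝕜) [⋀^Fin 2]→L[𝕜] 𝕜 :=
  (Λ (e.symm y)).compContinuousLinearMap
    (ContinuousLinearMap.precomp (E := TangentSpace 𝓘(𝕜, E) (e.symm y)) (F := E) 𝕜
      (mfderiv 𝓘(𝕜, E) 𝓘(𝕜, E) e (e.symm y)))

/-- Smoothness (holomorphy if `𝕜 = ℂ`) on an open set `U`. -/
def IsSmoothOn (Λ : BivectorField 𝕜 E M) (U : Set M) : Prop :=
  ∀ e ∈ atlas E M, ContDiffOn 𝕜 ∞ (Λ.inChart e) (e.target ∩ e.symm ⁻¹' U)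

/-- The bracket `{f, g} = Λ(df, dg)`. -/
def bracket (Λ : BivectorField 𝕜 E M) (f g : M → 𝕜) (p : M) : 𝕜 :=
  Λ p ![diff f p, diff g p]

/-- `Λ` is a Poisson structure on the open set `U`: it is smooth there and its bracket satisfies
the Jacobi identity for all locally defined smooth functions. -/
def IsPoissonOn (Λ : BivectorField 𝕜 E M) (U : Set M) : Prop :=
  Λ.IsSmoothOn U ∧
  ∀ V : Set M, IsOpen V → V ⊆ U → ∀ f g h : M → 𝕜,
    ContMDiffOn 𝓘(𝕜, E) 𝓘(𝕜, 𝕜) ∞ f V → ContMDiffOn 𝓘(𝕜, E) 𝓘(𝕜, 𝕜) ∞ g V →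
    ContMDiffOn 𝓘(𝕜, E) 𝓘(𝕜, 𝕜) ∞ h V →
    ∀ p ∈ V, Λ.bracket f (Λ.bracket g h) p + Λ.bracket g (Λ.bracket h f) p +
      Λ.bracket h (Λ.bracket f g) p = 0

/-- `Λ` is a Poisson structure on `M`. -/
def IsPoisson (Λ : BivectorField 𝕜 E M) : Prop :=
  Λ.IsPoissonOn Set.univ

/-- The image of `Λ` at `p`: the vectors `v = Λ(α, ·)`, for `α` a covector at `p`. -/
def im (Λ : BivectorField 𝕜 E M) (p : M) : Set (TangentSpace 𝓘(𝕜, E) p) :=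
  {v | ∃ α : TangentSpace 𝓘(𝕜, E) p →L[𝕜] 𝕜, ∀ β : TangentSpace 𝓘(𝕜, E) p →L[𝕜] 𝕜,
    β v = Λ p ![α, β]}

end BivectorField

/-! ### Couples of bi-vectors -/

/-- The couple is a Poisson pair: around each point, `Λ`, `Λ₁` and `Λ + Λ₁` are Poisson. -/
def IsPoissonPair (Λ Λ₁ : BivectorField 𝕜 E M) : Prop :=
  ∀ p : M, ∃ U : Set M, IsOpen U ∧ p ∈ U ∧ Λ.IsPoissonOn U ∧ Λ₁.IsPoissonOn U ∧
    BivectorField.IsPoissonOn (fun q => Λ q + Λ₁ q) U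

/-- The couple is flat: around each point there are coordinates in which `Λ` and `Λ₁` both have
constant coefficients. -/
def IsFlat (Λ Λ₁ : BivectorField 𝕜 E M) : Prop :=
  ∀ p : M, ∃ e ∈ IsManifold.maximalAtlas 𝓘(𝕜, E) ∞ M, p ∈ e.source ∧
    ∃ c c₁ : (E →L[𝕜] 𝕜) [⋀^Fin 2]→L[𝕜] 𝕜,
      ∀ y ∈ e.target, Λ.inChart e y = c ∧ Λ₁.inChart e y = c₁

/-- Genericity, at each point, of a couple of bi-vectors on a manifold of dimension three:
`a Λ + b Λ₁`, as a complex bi-vector, has no zeros for any `(a, b) ∈ ℂ² ∖ {0}`.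
The map `RCLike.map 𝕜 ℂ` is the inclusion of `𝕜` in `ℂ`. -/
def IsGeneric (Λ Λ₁ : BivectorField 𝕜 E M) : Prop :=
  ∀ (p : M) (a b : ℂ), (a, b) ≠ (0, 0) →
    ∃ α β : TangentSpace 𝓘(𝕜, E) p →L[𝕜] 𝕜,
      a * RCLike.map 𝕜 ℂ (Λ p ![α, β]) + b * RCLike.map 𝕜 ℂ (Λ₁ p ![α, β]) ≠ 0

/-- In dimension three, the `1`-form `w` and the volume form `Ω` represent the bi-vector `Λ`:
`α ∧ β ∧ w = Λ(α, β) Ω` for all covectors `α`, `β`. -/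
def Represents (w : DiffForm 𝕜 E M 1) (Ω : DiffForm 𝕜 E M 3) (Λ : BivectorField 𝕜 E M) : Prop :=
  ∀ (p : M) (α β : TangentSpace 𝓘(𝕜, E) p →L[𝕜] 𝕜),
    wedge α (wedge β (w p)) = Λ p ![α, β] • Ω p

end BiHam

end

/-!
In coordinates a `1`-form is a vector of coefficients `W`, its exterior derivative is `curl W`,
and the bi-vector it represents has the bracket `{f, g} = W · (∇f × ∇g) / ρ`, where `ρ` is the
coefficient of the volume form. The Jacobi identity for this bracket is `W · curl W = 0`.

Writing `W`, `W₁`, `L` for the coefficients of `w`, `w₁`, `lam`, the equations relating them are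
`curl W = L × W` and `curl W₁ = L × W₁`. Genericity makes `W` and `W₁` independent, so this linear
system has at most one solution `L`, and it is solvable exactly when `W · curl W`, `W₁ · curl W₁`
and `(W + W₁) · curl (W + W₁)` vanish, that is, when the couple is a Poisson pair.

Taking the divergence of both equations gives `W · curl L = W₁ · curl L = 0`, so `curl L` is a
multiple of `W × W₁`, which spans the intersection of the images of the two bi-vectors.

If `curl L = 0`, then locally `L = ∇g`, so `exp (-g) W` and `exp (-g) W₁` are gradients `∇x` and
`∇x₁`. Choosing a third function `z` whose derivative along `∇x × ∇x₁` is prescribed by `ρ` turns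
`(x, x₁, z)` into flat coordinates. In the other direction, in flat coordinates `W / ρ` and
`W₁ / ρ` are constant, which forces `L = ∇ρ / ρ`.
-/

namespace BiHam

open Matrix Topology Filter

section CrossProduct

variable {R : Type*} [CommRing R]

theorem triple_product_smul_eq_add_cross (a b c x : Fin 3 → R) :
    (a ⬝ᵥ b ⨯₃ c) • x =
      (a ⬝ᵥ x) • (b ⨯₃ c) + (b ⬝ᵥ x) • (c ⨯₃ a) + (c ⬝ᵥ x) • (a ⨯₃ b) := by
  simp only [vec3_dotProduct, cross_apply]
  ext i
  fin_cases i <;> simp <;> ring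

theorem triple_product_smul_eq_add (a b c x : Fin 3 → R) :
    (a ⬝ᵥ b ⨯₃ c) • x =
      (x ⬝ᵥ b ⨯₃ c) • a + (x ⬝ᵥ c ⨯₃ a) • b + (x ⬝ᵥ a ⨯₃ b) • c := by
  simp only [vec3_dotProduct, cross_apply]
  ext i
  fin_cases i <;> simp <;> ring

variable {K : Type*} [Field K] {a b c d x y : Fin 3 → K}

theorem exists_dot_ne_zero (h : x ≠ 0) : ∃ k : Fin 3 → K, k ⬝ᵥ x ≠ 0 := by
  by_contra! hx
  exact h (dotProduct_eq_zero_iff.1 fun k => by rw [dotProduct_comm, hx])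

theorem exists_eq_smul_cross (h : a ⨯₃ b ≠ 0) (ha : a ⬝ᵥ x = 0) (hb : b ⬝ᵥ x = 0) :
    ∃ t : K, x = t • a ⨯₃ b := by
  obtain ⟨k, hk⟩ := exists_dot_ne_zero h
  refine ⟨(k ⬝ᵥ a ⨯₃ b)⁻¹ * (k ⬝ᵥ x), ?_⟩
  rw [mul_smul, eq_inv_smul_iff₀ hk, triple_product_smul_eq_add_cross, ha, hb]
  simp

/-- The solution of `x ⨯₃ a = c`, `x ⨯₃ b = d`, with denominators cleared, for any `k`. -/
def crossSolution (a b c d k : Fin 3 → K) : Fin 3 → K :=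
  (c ⬝ᵥ b) • k + (d ⬝ᵥ k) • a - (c ⬝ᵥ k) • b

theorem smul_eq_crossSolution (hc : x ⨯₃ a = c) (hd : x ⨯₃ b = d) (k : Fin 3 → K) :
    (k ⬝ᵥ a ⨯₃ b) • x = crossSolution a b c d k := by
  rw [crossSolution, triple_product_smul_eq_add, ← hc, ← hd]
  simp only [dotProduct_comm (_ ⨯₃ _), triple_product_permutation b x a,
    triple_product_permutation k x, ← cross_anticomm a k, dotProduct_neg]
  rw [neg_smul, ← sub_eq_add_neg]

theorem exists_cross_eq (h : a ⨯₃ b ≠ 0) (ha : a ⬝ᵥ c = 0) (hb : b ⬝ᵥ d = 0)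
    (hab : a ⬝ᵥ d + b ⬝ᵥ c = 0) : ∃ x : Fin 3 → K, x ⨯₃ a = c ∧ x ⨯₃ b = d := by
  obtain ⟨k, hk⟩ := exists_dot_ne_zero h
  have hab' : a ⬝ᵥ d = -(b ⬝ᵥ c) := eq_neg_of_add_eq_zero_left hab
  refine ⟨(k ⬝ᵥ a ⨯₃ b)⁻¹ • crossSolution a b c d k, ?_, ?_⟩ <;>
    rw [LinearMap.map_smul, LinearMap.smul_apply, inv_smul_eq_iff₀ hk,
      triple_product_smul_eq_add_cross, crossSolution]
  · simp [ha, dotProduct_comm c, sub_eq_add_neg, ← smul_neg, cross_anticomm, add_comm]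
  · simp [hb, hab', dotProduct_comm c, dotProduct_comm d, ← smul_neg, cross_anticomm, add_comm]

theorem eq_of_cross_eq_cross (h : a ⨯₃ b ≠ 0) (ha : x ⨯₃ a = y ⨯₃ a) (hb : x ⨯₃ b = y ⨯₃ b) :
    x = y := by
  obtain ⟨k, hk⟩ := exists_dot_ne_zero h
  apply smul_right_injective _ hk
  exact (smul_eq_crossSolution ha hb k).trans (smul_eq_crossSolution rfl rfl k).symm

end CrossProduct

section VectorCalculus

variable {𝕜 : Type*} [RCLike 𝕜] {E : Type*} [NormedAddCommGroup E] [NormedSpace 𝕜 E]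

/-- The gradient of `f` in the frame `b`: its derivatives along the vectors of `b`. -/
noncomputable def grad (b : Fin 3 → E) (f : E → 𝕜) (y : E) : Fin 3 → 𝕜 :=
  fun i => fderiv 𝕜 f y (b i)

/-- The curl in the frame `b`: the coefficients of the exterior derivative of the `1`-form with
coefficients `W`. -/
noncomputable def curl (b : Fin 3 → E) (W : E → Fin 3 → 𝕜) (y : E) : Fin 3 → 𝕜 :=
  ![fderiv 𝕜 W y (b 1) 2 - fderiv 𝕜 W y (b 2) 1,
    fderiv 𝕜 W y (b 2) 0 - fderiv 𝕜 W y (b 0) 2,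
    fderiv 𝕜 W y (b 0) 1 - fderiv 𝕜 W y (b 1) 0]

/-- The divergence in the frame `b`: the coefficient of the exterior derivative of the `2`-form
with coefficients `V`. -/
noncomputable def divergence (b : Fin 3 → E) (V : E → Fin 3 → 𝕜) (y : E) : 𝕜 :=
  ∑ i, fderiv 𝕜 V y (b i) i

variable {b : Fin 3 → E} {f : E → 𝕜} {V W : E → Fin 3 → 𝕜} {y : E}

theorem curl_congr (h : V =ᶠ[𝓝 y] W) : curl b V y = curl b W y := by
  simp only [curl, h.fderiv_eq]

theorem curl_add (hV : DifferentiableAt 𝕜 V y) (hW : DifferentiableAt 𝕜 W y) :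
    curl b (fun z => V z + W z) y = curl b V y + curl b W y := by
  ext i
  fin_cases i <;> simp [curl, fderiv_fun_add hV hW] <;> ring

theorem curl_smul (hf : DifferentiableAt 𝕜 f y) (hW : DifferentiableAt 𝕜 W y) :
    curl b (fun z => f z • W z) y = f y • curl b W y + grad b f y ⨯₃ W y := by
  ext i
  fin_cases i <;> simp [curl, grad, fderiv_fun_smul hf hW, cross_apply] <;> ring

theorem dot_curl_smul (hf : DifferentiableAt 𝕜 f y) (hW : DifferentiableAt 𝕜 W y) :
    (f y • W y) ⬝ᵥ curl b (fun z => f z • W z) y = f y ^ 2 * (W y ⬝ᵥ curl b W y) := by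
  simp only [curl_smul hf hW, dotProduct_add, smul_dotProduct, dotProduct_smul, dot_cross_self,
    smul_eq_mul]
  ring

theorem divergence_add (hV : DifferentiableAt 𝕜 V y) (hW : DifferentiableAt 𝕜 W y) :
    divergence b (fun z => V z + W z) y = divergence b V y + divergence b W y := by
  simp [divergence, fderiv_fun_add hV hW, Finset.sum_add_distrib]

theorem divergence_smul (hf : DifferentiableAt 𝕜 f y) (hV : DifferentiableAt 𝕜 V y) :
    divergence b (fun z => f z • V z) y = f y * divergence b V y + grad b f y ⬝ᵥ V y := by
  simp [divergence, grad, fderiv_fun_smul hf hV, Finset.sum_add_distrib, Finset.mul_sum,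
    dotProduct]

theorem fderiv_cross_apply (hV : DifferentiableAt 𝕜 V y) (hW : DifferentiableAt 𝕜 W y) (v : E) :
    fderiv 𝕜 (fun z => V z ⨯₃ W z) y v = V y ⨯₃ fderiv 𝕜 W y v + fderiv 𝕜 V y v ⨯₃ W y := by
  have := (crossProduct (R := 𝕜)).toContinuousBilinearMap.fderiv_of_bilinear hV hW
  exact congr($this v)

theorem divergence_cross (hV : DifferentiableAt 𝕜 V y) (hW : DifferentiableAt 𝕜 W y) :
    divergence b (fun z => V z ⨯₃ W z) y = W y ⬝ᵥ curl b V y - V y ⬝ᵥ curl b W y := by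
  simp only [divergence, fderiv_cross_apply hV hW]
  simp only [Fin.sum_univ_three, curl, vec3_dotProduct, cross_apply]
  simp
  ring

theorem contDiffAt_fderiv_apply {F : Type*} [NormedAddCommGroup F] [NormedSpace 𝕜 F] {f : E → F}
    (hf : ContDiffAt 𝕜 ∞ f y) (v : E) : ContDiffAt 𝕜 ∞ (fun z => fderiv 𝕜 f z v) y :=
  (hf.fderiv_right (by simp)).clm_apply contDiffAt_const

theorem fderiv_fderiv_apply_comm {F : Type*} [NormedAddCommGroup F] [NormedSpace 𝕜 F] {f : E → F}
    (hf : ContDiffAt 𝕜 ∞ f y) (u v : E) :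
    fderiv 𝕜 (fun z => fderiv 𝕜 f z u) y v = fderiv 𝕜 (fun z => fderiv 𝕜 f z v) y u := by
  have hd : DifferentiableAt 𝕜 (fderiv 𝕜 f) y :=
    (hf.fderiv_right (m := ∞) (by simp)).differentiableAt (by simp)
  have hsymm : IsSymmSndFDerivAt 𝕜 f y := hf.isSymmSndFDerivAt (by simpa using ENat.LEInfty.out)
  simpa [fderiv_clm_apply hd (differentiableAt_const _)] using hsymm.eq v u

theorem fderiv_pi_apply {n : ℕ} {V : E → Fin n → 𝕜} (hV : DifferentiableAt 𝕜 V y) (v : E)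
    (i : Fin n) : fderiv 𝕜 V y v i = fderiv 𝕜 (fun z => V z i) y v :=
  (congr($(fderiv_apply hV i) v)).symm

theorem grad_eq_single_of_eventuallyEq_coord
    {b : Module.Basis (Fin 3) 𝕜 E} {i : Fin 3} (h : f =ᶠ[𝓝 y] b.coord i) :
    grad b f y = Pi.single i 1 := by
  have := Module.Finite.of_basis b
  have hclm : f =ᶠ[𝓝 y] (b.coord i).toContinuousLinearMap := h
  ext j
  rw [grad, hclm.fderiv_eq, ContinuousLinearMap.fderiv]
  simp [Finsupp.single_apply, Pi.single_apply, eq_comm]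

theorem contDiffAt_grad (hf : ContDiffAt 𝕜 ∞ f y) : ContDiffAt 𝕜 ∞ (grad b f) y :=
  contDiffAt_pi.2 fun _ => contDiffAt_fderiv_apply hf _

theorem contDiffAt_curl (hW : ContDiffAt 𝕜 ∞ W y) : ContDiffAt 𝕜 ∞ (curl b W) y := by
  have h (i j) : ContDiffAt 𝕜 ∞ (fun z => fderiv 𝕜 W z (b i) j) y :=
    contDiffAt_pi.1 (contDiffAt_fderiv_apply hW _) j
  refine contDiffAt_pi.2 fun i => ?_
  fin_cases i <;> exact (h _ _).sub (h _ _)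

theorem curl_grad (hf : ContDiffAt 𝕜 ∞ f y) : curl b (grad b f) y = 0 := by
  have h : DifferentiableAt 𝕜 (grad b f) y := (contDiffAt_grad hf).differentiableAt (by simp)
  ext i
  fin_cases i <;>
    simp [curl, fderiv_pi_apply h, grad, fderiv_fderiv_apply_comm hf (b 0),
      fderiv_fderiv_apply_comm hf (b 1) (b 2)]

theorem divergence_curl (hW : ContDiffAt 𝕜 ∞ W y) : divergence b (curl b W) y = 0 := by
  have hd (i) : DifferentiableAt 𝕜 (fun z => fderiv 𝕜 W z (b i)) y :=
    (contDiffAt_fderiv_apply hW _).differentiableAt (by simp)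
  have hsymm (i j k) : fderiv 𝕜 (fun z => fderiv 𝕜 W z (b i) k) y (b j) =
      fderiv 𝕜 (fun z => fderiv 𝕜 W z (b j) k) y (b i) := by
    rw [← fderiv_pi_apply (hd i), ← fderiv_pi_apply (hd j), fderiv_fderiv_apply_comm hW]
  have hcurl := (contDiffAt_curl (b := b) hW).differentiableAt (by simp)
  have hdk (i k) := differentiableAt_pi.1 (hd i) k
  simp only [divergence, Fin.sum_univ_three, fderiv_pi_apply hcurl]
  simp [curl, fderiv_fun_sub (hdk _ _) (hdk _ _), hsymm 0, hsymm 1 2]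

/-- Since `div (curl W) = 0` and `L ⨯₃ W` is orthogonal to `L`. -/
theorem dot_curl_eq_zero_of_curl_eq_cross {L : E → Fin 3 → 𝕜} (hW : ContDiffAt 𝕜 ∞ W y)
    (hL : DifferentiableAt 𝕜 L y) (h : curl b W =ᶠ[𝓝 y] fun z => L z ⨯₃ W z) :
    W y ⬝ᵥ curl b L y = 0 := by
  have hdiv : divergence b (curl b W) y = divergence b (fun z => L z ⨯₃ W z) y := by
    simp only [divergence, h.fderiv_eq]
  rw [divergence_curl hW, divergence_cross hL (hW.differentiableAt (by simp)),
    h.self_of_nhds, dot_self_cross, sub_zero] at hdiv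
  exact hdiv.symm

theorem curl_eq_zero_of_smul_eq_grad {L : E → Fin 3 → 𝕜} (hf : ContDiffAt 𝕜 ∞ f y) (h0 : f y ≠ 0)
    (hL : DifferentiableAt 𝕜 L y) (h : grad b f =ᶠ[𝓝 y] fun z => f z • L z) :
    curl b L y = 0 := by
  have hcurl := curl_grad (b := b) hf
  rw [curl_congr h, curl_smul (hf.differentiableAt (by simp)) hL, h.self_of_nhds, map_smul,
    LinearMap.smul_apply, cross_self, smul_zero, add_zero] at hcurl
  exact (smul_eq_zero.1 hcurl).resolve_left h0

/-- The bracket `{f, g} = V · (∇f × ∇g)` on functions defined by the vector of coefficients `V`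
of a bi-vector field in the frame `b`. -/
noncomputable def localBracket (b : Fin 3 → E) (V : E → Fin 3 → 𝕜) (f g : E → 𝕜) (y : E) : 𝕜 :=
  V y ⬝ᵥ grad b f y ⨯₃ grad b g y

theorem grad_congr {g : E → 𝕜} (h : f =ᶠ[𝓝 y] g) : grad b f y = grad b g y := by
  unfold grad
  rw [h.fderiv_eq]

theorem localBracket_congr {f' g g' : E → 𝕜} (hf : f =ᶠ[𝓝 y] f') (hg : g =ᶠ[𝓝 y] g') :
    localBracket b V f g y = localBracket b V f' g' y := by
  rw [localBracket, localBracket, grad_congr hf, grad_congr hg]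

theorem contDiffAt_dotProduct (hV : ContDiffAt 𝕜 ∞ V y) (hW : ContDiffAt 𝕜 ∞ W y) :
    ContDiffAt 𝕜 ∞ (fun z => V z ⬝ᵥ W z) y :=
  ContDiffAt.sum fun i _ => (contDiffAt_pi.1 hV i).mul (contDiffAt_pi.1 hW i)

theorem contDiffAt_cross (hV : ContDiffAt 𝕜 ∞ V y) (hW : ContDiffAt 𝕜 ∞ W y) :
    ContDiffAt 𝕜 ∞ (fun z => V z ⨯₃ W z) y :=
  (crossProduct (R := 𝕜)).toContinuousBilinearMap.isBoundedBilinearMap.contDiff.contDiffAt.comp y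
    (hV.prodMk hW)

theorem contDiffAt_crossSolution {C D : E → Fin 3 → 𝕜} (hV : ContDiffAt 𝕜 ∞ V y)
    (hW : ContDiffAt 𝕜 ∞ W y) (hC : ContDiffAt 𝕜 ∞ C y) (hD : ContDiffAt 𝕜 ∞ D y)
    (k : Fin 3 → 𝕜) : ContDiffAt 𝕜 ∞ (fun z => crossSolution (V z) (W z) (C z) (D z) k) y :=
  (((contDiffAt_dotProduct hC hW).smul contDiffAt_const).add
    ((contDiffAt_dotProduct hD contDiffAt_const).smul hV)).sub
    ((contDiffAt_dotProduct hC contDiffAt_const).smul hW)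

theorem contDiffAt_localBracket {g : E → 𝕜} (hV : ContDiffAt 𝕜 ∞ V y) (hf : ContDiffAt 𝕜 ∞ f y)
    (hg : ContDiffAt 𝕜 ∞ g y) : ContDiffAt 𝕜 ∞ (localBracket b V f g) y :=
  contDiffAt_dotProduct hV (contDiffAt_cross (contDiffAt_grad hf) (contDiffAt_grad hg))

theorem localBracket_eq_divergence_sub {φ : E → 𝕜} (hV : ContDiffAt 𝕜 ∞ V y)
    (hf : ContDiffAt 𝕜 ∞ f y) (hφ : DifferentiableAt 𝕜 φ y) :
    localBracket b V f φ y = divergence b (fun z => φ z • V z ⨯₃ grad b f z) y -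
      φ y * (grad b f y ⬝ᵥ curl b V y) := by
  have hVd := hV.differentiableAt (by simp)
  have hgrad := (contDiffAt_grad (b := b) hf).differentiableAt (by simp)
  rw [divergence_smul hφ
      ((contDiffAt_cross hV (contDiffAt_grad hf)).differentiableAt (by simp)),
    divergence_cross hVd hgrad, curl_grad hf, localBracket, dotProduct_zero, sub_zero,
    triple_product_permutation, triple_product_permutation]
  ring

/-- The divergence terms add up to the divergence of `(∇f · ∇g × ∇h) V × V = 0`, by expansion of
`V` in terms of the three gradients. -/
theorem localBracket_jacobi {g h : E → 𝕜} (hV : ContDiffAt 𝕜 ∞ V y)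
    (hf : ContDiffAt 𝕜 ∞ f y) (hg : ContDiffAt 𝕜 ∞ g y) (hh : ContDiffAt 𝕜 ∞ h y) :
    localBracket b V f (localBracket b V g h) y + localBracket b V g (localBracket b V h f) y +
      localBracket b V h (localBracket b V f g) y =
    -((V y ⬝ᵥ curl b V y) * (grad b f y ⬝ᵥ grad b g y ⨯₃ grad b h y)) := by
  have hexp (z) : localBracket b V g h z • grad b f z + localBracket b V h f z • grad b g z +
      localBracket b V f g z • grad b h z = (grad b f z ⬝ᵥ grad b g z ⨯₃ grad b h z) • V z :=
    (triple_product_smul_eq_add _ _ _ _).symm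
  have hd {f g h : E → 𝕜} (hf : ContDiffAt 𝕜 ∞ f y) (hg : ContDiffAt 𝕜 ∞ g y)
      (hh : ContDiffAt 𝕜 ∞ h y) : DifferentiableAt 𝕜
        (fun z => localBracket b V g h z • V z ⨯₃ grad b f z) y :=
    ((contDiffAt_localBracket hV hg hh).smul
      (contDiffAt_cross hV (contDiffAt_grad hf))).differentiableAt (by simp)
  have hdiv : divergence b (fun z => localBracket b V g h z • V z ⨯₃ grad b f z) y +
      divergence b (fun z => localBracket b V h f z • V z ⨯₃ grad b g z) y +
      divergence b (fun z => localBracket b V f g z • V z ⨯₃ grad b h z) y = 0 := by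
    rw [← divergence_add (hd hf hg hh) (hd hg hh hf),
      ← divergence_add ((hd hf hg hh).fun_add (hd hg hh hf)) (hd hh hf hg)]
    simp only [← map_smul, ← map_add, hexp]
    simp [divergence]
  have hdot := congr($(hexp y) ⬝ᵥ curl b V y)
  simp only [add_dotProduct, smul_dotProduct, smul_eq_mul] at hdot
  rw [localBracket_eq_divergence_sub hV hf
      ((contDiffAt_localBracket hV hg hh).differentiableAt (by simp)),
    localBracket_eq_divergence_sub hV hg
      ((contDiffAt_localBracket hV hh hf).differentiableAt (by simp)),
    localBracket_eq_divergence_sub hV hh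
      ((contDiffAt_localBracket hV hf hg).differentiableAt (by simp))]
  linear_combination hdiv - hdot

end VectorCalculus

section AlternatingForms

variable {𝕜 : Type*} [RCLike 𝕜]

section Algebra

variable {F : Type*} [AddCommGroup F] [Module 𝕜 F] [TopologicalSpace F]

/-- The values of an alternating bilinear form on the pairs of vectors of a family `c`, ordered in
such a way that the form becomes a triple product (`apply_sum_smul`). -/
def axial (c : Fin 3 → F) (η : F [⋀^Fin 2]→L[𝕜] 𝕜) : Fin 3 → 𝕜 :=
  ![η ![c 1, c 2], η ![c 2, c 0], η ![c 0, c 1]]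

theorem apply_pair_self (η : F [⋀^Fin 2]→L[𝕜] 𝕜) (u : F) : η ![u, u] = 0 :=
  η.map_eq_zero_of_eq ![u, u] (i := 0) (j := 1) rfl (by decide)

theorem apply_pair_swap (η : F [⋀^Fin 2]→L[𝕜] 𝕜) (u v : F) : η ![u, v] = -η ![v, u] := by
  have h : ![v, u] ∘ Equiv.swap (0 : Fin 2) 1 = ![u, v] := by ext i; fin_cases i <;> simp
  rw [← h]
  exact η.toAlternatingMap.map_swap ![v, u] (i := 0) (j := 1) (by decide)

theorem apply_sum_smul (c : Fin 3 → F) (η : F [⋀^Fin 2]→L[𝕜] 𝕜) (x y : Fin 3 → 𝕜) :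
    η ![∑ i, x i • c i, ∑ i, y i • c i] = axial c η ⬝ᵥ x ⨯₃ y := by
  have hleft (z : Fin 3 → 𝕜) (v : F) : η ![∑ i, z i • c i, v] = ∑ i, z i * η ![c i, v] := by
    simp only [Fin.sum_univ_three, η.vecCons_add, η.vecCons_smul, smul_eq_mul]
  have hright (u : F) : η ![u, ∑ i, y i • c i] = ∑ i, y i * η ![u, c i] := by
    rw [apply_pair_swap, hleft, ← Finset.sum_neg_distrib]
    exact Finset.sum_congr rfl fun i _ => by rw [apply_pair_swap, mul_neg, neg_neg]
  rw [hleft]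
  simp only [hright]
  simp only [Fin.sum_univ_three, axial, vec3_dotProduct, cross_apply,
    apply_pair_self, apply_pair_swap η (c 1) (c 0), apply_pair_swap η (c 2) (c 1),
    apply_pair_swap η (c 0) (c 2), cons_val_zero, cons_val_one, cons_val]
  ring

theorem eq_of_axial_eq (b : Module.Basis (Fin 3) 𝕜 F) {η ζ : F [⋀^Fin 2]→L[𝕜] 𝕜}
    (h : axial b η = axial b ζ) : η = ζ := by
  ext v
  have hv : v = ![∑ i, b.repr (v 0) i • b i, ∑ i, b.repr (v 1) i • b i] := by
    ext i
    fin_cases i <;> simp [b.sum_repr]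
  rw [hv, apply_sum_smul, apply_sum_smul, h]

theorem eq_of_apply_singleton_eq {ι : Type*} [Finite ι] (b : Module.Basis ι 𝕜 F)
    {η ζ : F [⋀^Fin 1]→L[𝕜] 𝕜} (h : ∀ i, η ![b i] = ζ ![b i]) : η = ζ := by
  refine ContinuousAlternatingMap.toAlternatingMap_injective (b.ext_alternating fun v _ => ?_)
  have hv : (fun i => b (v i)) = ![b (v 0)] := by ext i; fin_cases i; rfl
  rw [hv]
  exact h (v 0)

theorem eq_of_apply_pair_eq {η ζ : F [⋀^Fin 2]→L[𝕜] 𝕜} (h : ∀ u v, η ![u, v] = ζ ![u, v]) :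
    η = ζ := by
  ext v
  have hv : v = ![v 0, v 1] := by ext i; fin_cases i <;> rfl
  rw [hv, h]

theorem eq_of_apply_basis_eq {ι : Type*} [Finite ι] (b : Module.Basis ι 𝕜 F)
    {η ζ : F [⋀^ι]→L[𝕜] 𝕜} (h : η b = ζ b) : η = ζ := by
  classical
  have := Fintype.ofFinite ι
  apply ContinuousAlternatingMap.toAlternatingMap_injective
  rw [η.toAlternatingMap.eq_smul_basis_det b, ζ.toAlternatingMap.eq_smul_basis_det b]
  exact congr($h • b.det)

end Algebra

section ExteriorCalculus

variable {E : Type*} [NormedAddCommGroup E] [NormedSpace 𝕜 E]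

theorem axial_extDeriv (b : Fin 3 → E) {θ : E → E [⋀^Fin 1]→L[𝕜] 𝕜} {y : E}
    (h : DifferentiableAt 𝕜 θ y) :
    axial b (extDeriv θ y) = curl b (fun z i => θ z ![b i]) y := by
  have hpair (u v : E) : extDeriv θ y ![u, v] =
      fderiv 𝕜 (fun z => θ z ![v]) y u - fderiv 𝕜 (fun z => θ z ![u]) y v := by
    have h0 : Fin.removeNth 0 ![u, v] = ![v] := by ext i; fin_cases i; rfl
    have h1 : Fin.removeNth 1 ![u, v] = ![u] := by ext i; fin_cases i; rfl
    simp [extDeriv_apply h, Fin.sum_univ_two, h0, h1, sub_eq_add_neg]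
  have hd : DifferentiableAt 𝕜 (fun z i => θ z ![b i]) y :=
    differentiableAt_pi.2 fun _ => h.continuousAlternatingMap_apply_const _
  simp only [axial, curl, hpair, fderiv_pi_apply hd]

variable {M : Type*} [TopologicalSpace M] [ChartedSpace E M] {p : M}

theorem wedge_apply {k : ℕ} (α : TangentSpace 𝓘(𝕜, E) p →L[𝕜] 𝕜)
    (η : TangentSpace 𝓘(𝕜, E) p [⋀^Fin k]→L[𝕜] 𝕜) (v : Fin (k + 1) → TangentSpace 𝓘(𝕜, E) p) :
    wedge α η v = ∑ i : Fin (k + 1), (-1) ^ (i : ℕ) * (α (v i) * η (i.removeNth v)) := by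
  refine (ContinuousAlternatingMap.alternatizeUncurryFin_apply (𝕜 := 𝕜) (E := E) _ v).trans ?_
  exact Finset.sum_congr rfl fun i _ => by rw [zsmul_eq_mul]; push_cast; rfl

theorem wedge_add {k : ℕ} (α : TangentSpace 𝓘(𝕜, E) p →L[𝕜] 𝕜)
    (η ζ : TangentSpace 𝓘(𝕜, E) p [⋀^Fin k]→L[𝕜] 𝕜) :
    wedge α (η + ζ) = wedge α η + wedge α ζ := by
  ext v
  simp only [wedge_apply, ContinuousAlternatingMap.add_apply, mul_add, Finset.sum_add_distrib]

theorem wedge_smul {k : ℕ} (α : TangentSpace 𝓘(𝕜, E) p →L[𝕜] 𝕜) (s : 𝕜)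
    (η : TangentSpace 𝓘(𝕜, E) p [⋀^Fin k]→L[𝕜] 𝕜) : wedge α (s • η) = s • wedge α η := by
  ext v
  simp only [wedge_apply, ContinuousAlternatingMap.smul_apply, smul_eq_mul, Finset.mul_sum,
    mul_left_comm s]

theorem wedge_zero {k : ℕ} (α : TangentSpace 𝓘(𝕜, E) p →L[𝕜] 𝕜) :
    wedge α (0 : TangentSpace 𝓘(𝕜, E) p [⋀^Fin k]→L[𝕜] 𝕜) = 0 := by
  ext v
  exact (wedge_apply α 0 v).trans (Finset.sum_eq_zero fun i _ => by
    rw [ContinuousAlternatingMap.coe_zero, Pi.zero_apply, mul_zero, mul_zero])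

theorem wedge_apply_pair (α : TangentSpace 𝓘(𝕜, E) p →L[𝕜] 𝕜)
    (η : TangentSpace 𝓘(𝕜, E) p [⋀^Fin 1]→L[𝕜] 𝕜) (u v : TangentSpace 𝓘(𝕜, E) p) :
    wedge α η ![u, v] = α u * η ![v] - α v * η ![u] := by
  have h0 : Fin.removeNth 0 ![u, v] = ![v] := by ext i; fin_cases i; rfl
  have h1 : Fin.removeNth 1 ![u, v] = ![u] := by ext i; fin_cases i; rfl
  simp [wedge_apply, Fin.sum_univ_two, h0, h1, sub_eq_add_neg]

theorem axial_wedge (c : Fin 3 → TangentSpace 𝓘(𝕜, E) p)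
    (α : TangentSpace 𝓘(𝕜, E) p →L[𝕜] 𝕜) (η : TangentSpace 𝓘(𝕜, E) p [⋀^Fin 1]→L[𝕜] 𝕜) :
    axial c (wedge α η) = (fun i => α (c i)) ⨯₃ fun i => η ![c i] := by
  simp only [axial, wedge_apply_pair, cross_apply]

theorem wedge_apply_three (c : Fin 3 → TangentSpace 𝓘(𝕜, E) p)
    (α : TangentSpace 𝓘(𝕜, E) p →L[𝕜] 𝕜) (η : TangentSpace 𝓘(𝕜, E) p [⋀^Fin 2]→L[𝕜] 𝕜) :
    wedge α η c = (fun i => α (c i)) ⬝ᵥ axial c η := by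
  have h0 : Fin.removeNth 0 c = ![c 1, c 2] := by ext i; fin_cases i <;> rfl
  have h1 : Fin.removeNth 1 c = ![c 0, c 2] := by ext i; fin_cases i <;> rfl
  have h2 : Fin.removeNth 2 c = ![c 0, c 1] := by ext i; fin_cases i <;> rfl
  simp [wedge_apply, Fin.sum_univ_three, h0, h1, h2, dotProduct, axial,
    apply_pair_swap η (c 0) (c 2)]

theorem wedge_wedge_apply (c : Fin 3 → TangentSpace 𝓘(𝕜, E) p)
    (α β : TangentSpace 𝓘(𝕜, E) p →L[𝕜] 𝕜) (η : TangentSpace 𝓘(𝕜, E) p [⋀^Fin 1]→L[𝕜] 𝕜) :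
    wedge α (wedge β η) c =
      (fun i => α (c i)) ⬝ᵥ (fun i => β (c i)) ⨯₃ fun i => η ![c i] := by
  rw [wedge_apply_three, axial_wedge]

end ExteriorCalculus

end AlternatingForms

section Primitives

variable {𝕜 : Type*} [RCLike 𝕜] {E : Type*} [NormedAddCommGroup E] [NormedSpace 𝕜 E]

theorem fderiv_symm_of_curl_eq_zero (b : Module.Basis (Fin 3) 𝕜 E) {W : E → Fin 3 → 𝕜} {y : E}
    (h : curl b W y = 0) (u v : E) :
    ∑ i, b.equivFun v i * fderiv 𝕜 W y u i = ∑ i, b.equivFun u i * fderiv 𝕜 W y v i := by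
  have h0 : fderiv 𝕜 W y (b 1) 2 = fderiv 𝕜 W y (b 2) 1 := sub_eq_zero.1 (congrFun h 0)
  have h1 : fderiv 𝕜 W y (b 2) 0 = fderiv 𝕜 W y (b 0) 2 := sub_eq_zero.1 (congrFun h 1)
  have h2 : fderiv 𝕜 W y (b 0) 1 = fderiv 𝕜 W y (b 1) 0 := sub_eq_zero.1 (congrFun h 2)
  have hexp (u i) : fderiv 𝕜 W y u i = ∑ j, b.equivFun u j * fderiv 𝕜 W y (b j) i := by
    conv_lhs => rw [← b.sum_equivFun u, map_sum]
    simp only [map_smul, Finset.sum_apply, Pi.smul_apply, smul_eq_mul]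
  simp only [hexp u, hexp v, Fin.sum_univ_three, h0, h1, h2]
  ring

theorem exists_grad_eq_of_curl_eq_zero (b : Module.Basis (Fin 3) 𝕜 E)
    {W : E → Fin 3 → 𝕜} {y₀ : E} (hW : ∀ᶠ y in 𝓝 y₀, ContDiffAt 𝕜 ∞ W y)
    (h : ∀ᶠ y in 𝓝 y₀, curl b W y = 0) :
    ∃ f : E → 𝕜, ∀ᶠ y in 𝓝 y₀, ContDiffAt 𝕜 ∞ f y ∧ grad b f y = W y := by
  have := Module.Finite.of_basis b
  let : NormedSpace ℝ E := NormedSpace.restrictScalars ℝ 𝕜 E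
  have : IsScalarTower ℝ 𝕜 E := ⟨fun _ _ _ => by simp⟩
  let T : (Fin 3 → 𝕜) →L[𝕜] E →L[𝕜] 𝕜 :=
    ∑ i, (ContinuousLinearMap.proj i).smulRight
      ((ContinuousLinearMap.proj i).comp (b.equivFunL : E →L[𝕜] Fin 3 → 𝕜))
  have hT (x : Fin 3 → 𝕜) (v : E) : T x v = ∑ i, b.equivFun v i * x i := by
    simp [T, _root_.sum_apply, mul_comm]
  obtain ⟨r, hr, hball⟩ := Metric.eventually_nhds_iff_ball.1 (hW.and h)
  have hTW (y) (hy : y ∈ Metric.ball y₀ r) :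
      HasFDerivAt (fun y => T (W y)) (T.comp (fderiv 𝕜 W y)) y :=
    T.hasFDerivAt.comp y ((hball y hy).1.differentiableAt (by simp)).hasFDerivAt
  have hTW' (y) (hy : y ∈ Metric.ball y₀ r) := ((hTW y hy).restrictScalars ℝ).hasFDerivWithinAt
    (s := Metric.ball y₀ r)
  obtain ⟨f, hf⟩ :=
    (convex_ball y₀ r).exists_forall_hasFDerivWithinAt_of_hasFDerivWithinAt_symmetric hTW'
      fun y hy u _ v _ => by
        simpa only [ContinuousLinearMap.coe_restrictScalars', ContinuousLinearMap.comp_apply, hT]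
          using fderiv_symm_of_curl_eq_zero b (hball y hy).2 u v
  have hf' (y) (hy : y ∈ Metric.ball y₀ r) : HasFDerivAt f (T (W y)) y :=
    (hf y hy).hasFDerivAt (Metric.isOpen_ball.mem_nhds hy)
  have hsmooth : ContDiffOn 𝕜 ∞ f (Metric.ball y₀ r) := by
    rw [contDiffOn_infty_iff_fderiv_of_isOpen Metric.isOpen_ball]
    refine ⟨fun y hy => (hf' y hy).differentiableAt.differentiableWithinAt, fun y hy => ?_⟩
    exact (T.contDiff.contDiffAt.comp y (hball y hy).1).contDiffWithinAt.congr
      (fun z hz => (hf' z hz).fderiv) (hf' y hy).fderiv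
  refine ⟨f, ?_⟩
  filter_upwards [Metric.ball_mem_nhds y₀ hr] with y hy
  refine ⟨hsmooth.contDiffAt (Metric.isOpen_ball.mem_nhds hy), funext fun i => ?_⟩
  simp [grad, (hf' y hy).fderiv, hT]

/-- The weighted mean of `h` over the segment from `P x` to `P x + Q x`. For complementary
projections `P` and `Q` this yields primitives in the direction of the range of `Q`. The weight
makes the class of these functions stable under differentiation. -/
noncomputable def weightedMean (P Q : E →L[𝕜] E) (c : ℝ → 𝕜) (h : E → 𝕜) (x : E) : 𝕜 :=
  ∫ t in (0 : ℝ)..1, c t * h (P x + (t : 𝕜) • Q x)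

/-- The set `U` contains the segments over which the weighted means at its points are taken. -/
def ContainsSegments (P Q : E →L[𝕜] E) (U : Set E) : Prop :=
  ∀ t ∈ Set.Icc (0 : ℝ) 1, ∀ x ∈ U, P x + (t : 𝕜) • Q x ∈ U

theorem intervalIntegrable_of_continuousOn_prod {X G : Type*} [TopologicalSpace X]
    [NormedAddCommGroup G] {U : Set X} {g : X → ℝ → G}
    (hg : ContinuousOn (Function.uncurry g) (U ×ˢ Set.Icc 0 1)) {x : X} (hx : x ∈ U) :
    IntervalIntegrable (g x) MeasureTheory.volume 0 1 := by
  apply ContinuousOn.intervalIntegrable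
  rw [Set.uIcc_of_le zero_le_one]
  exact hg.comp (f := fun t : ℝ => (x, t)) (by fun_prop) fun t ht => ⟨hx, ht⟩

theorem contDiffOn_fderiv_apply {F : Type*} [NormedAddCommGroup F] [NormedSpace 𝕜 F]
    {h : E → F} {U : Set E} (hU : IsOpen U) (hh : ContDiffOn 𝕜 ∞ h U) (v : E) :
    ContDiffOn 𝕜 ∞ (fun x => fderiv 𝕜 h x v) U :=
  (hh.fderiv_of_isOpen hU (by simp)).clm_apply contDiffOn_const

variable {P Q : E →L[𝕜] E} {U : Set E} {c : ℝ → 𝕜} {h : E → 𝕜}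

theorem weightedMean_const_mul (a : 𝕜) (x : E) :
    weightedMean P Q c (fun z => a * h z) x = a * weightedMean P Q c h x := by
  simp only [weightedMean, mul_left_comm _ a]
  exact intervalIntegral.integral_const_mul _ _

namespace ContainsSegments

theorem continuousOn_comp {G : Type*} [TopologicalSpace G] (hPQ : ContainsSegments P Q U)
    {g : E → G} (hg : ContinuousOn g U) :
    ContinuousOn (fun p : E × ℝ => g (P p.1 + (p.2 : 𝕜) • Q p.1)) (U ×ˢ Set.Icc 0 1) := by
  refine hg.comp (Continuous.continuousOn ?_) fun p hp => hPQ p.2 hp.2 p.1 hp.1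
  have : Continuous fun p : E × ℝ => (p.2 : 𝕜) := RCLike.continuous_ofReal.comp continuous_snd
  fun_prop

theorem continuousOn_mul (hPQ : ContainsSegments P Q U) (hc : Continuous c)
    (hh : ContinuousOn h U) :
    ContinuousOn (Function.uncurry fun x (t : ℝ) => c t * h (P x + (t : 𝕜) • Q x))
      (U ×ˢ Set.Icc 0 1) :=
  (hc.comp continuous_snd).continuousOn.mul (hPQ.continuousOn_comp hh)

theorem continuousOn_smul_fderiv (hPQ : ContainsSegments P Q U) (hU : IsOpen U)
    (hc : Continuous c) (hh : ContDiffOn 𝕜 ∞ h U) :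
    ContinuousOn (Function.uncurry fun x (t : ℝ) =>
      c t • (fderiv 𝕜 h (P x + (t : 𝕜) • Q x)).comp (P + (t : 𝕜) • Q)) (U ×ˢ Set.Icc 0 1) := by
  have : Continuous fun p : E × ℝ => (p.2 : 𝕜) := RCLike.continuous_ofReal.comp continuous_snd
  refine (hc.comp continuous_snd).continuousOn.smul (ContinuousOn.clm_comp
    (hPQ.continuousOn_comp (hh.continuousOn_fderiv_of_isOpen hU (by simp)))
    (Continuous.continuousOn ?_))
  fun_prop

theorem hasFDerivAt_weightedMean [FiniteDimensional 𝕜 E] (hPQ : ContainsSegments P Q U)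
    (hU : IsOpen U) (hc : Continuous c) (hh : ContDiffOn 𝕜 ∞ h U) {x : E} (hx : x ∈ U) :
    HasFDerivAt (weightedMean P Q c h)
      (∫ t in (0 : ℝ)..1, c t • (fderiv 𝕜 h (P x + (t : 𝕜) • Q x)).comp (P + (t : 𝕜) • Q)) x := by
  have := FiniteDimensional.proper_rclike 𝕜 E
  obtain ⟨ε, hε, hball⟩ := Metric.nhds_basis_closedBall.mem_iff.1 (hU.mem_nhds hx)
  have hF' := hPQ.continuousOn_smul_fderiv hU hc hh
  obtain ⟨C, hC⟩ := ((isCompact_closedBall x ε).prod (isCompact_Icc (a := (0 : ℝ)) (b := 1))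
    ).exists_bound_of_continuousOn (hF'.mono (Set.prod_mono hball le_rfl))
  have hI : Set.uIoc (0 : ℝ) 1 ⊆ Set.Icc 0 1 := by
    rw [Set.uIoc_of_le zero_le_one]
    exact Set.Ioc_subset_Icc_self
  have hint {z : E} (hz : z ∈ U) :=
    intervalIntegrable_of_continuousOn_prod (hPQ.continuousOn_mul hc hh.continuousOn) hz
  refine intervalIntegral.hasFDerivAt_integral_of_dominated_of_fderiv_le (𝕜 := 𝕜)
    (bound := fun _ => C) (Metric.closedBall_mem_nhds x hε) ?_ (hint hx)
    (intervalIntegrable_iff.1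
      (intervalIntegrable_of_continuousOn_prod hF' hx)).aestronglyMeasurable
    (.of_forall fun t ht z hz => hC (z, t) ⟨hz, hI ht⟩) (by simp)
    (.of_forall fun t ht z hz => ?_)
  · filter_upwards [hU.mem_nhds hx] with z hz
    exact (intervalIntegrable_iff.1 (hint hz)).aestronglyMeasurable
  · have hz' := hh.contDiffAt (hU.mem_nhds (hPQ t (hI ht) z (hball hz)))
    exact ((hz'.differentiableAt (by simp)).hasFDerivAt.comp z
      (P + (t : 𝕜) • Q).hasFDerivAt).const_mul (c t)

theorem fderiv_weightedMean_apply [FiniteDimensional 𝕜 E] (hPQ : ContainsSegments P Q U)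
    (hU : IsOpen U) (hc : Continuous c) (hh : ContDiffOn 𝕜 ∞ h U) {x : E} (hx : x ∈ U) (v : E) :
    fderiv 𝕜 (weightedMean P Q c h) x v =
      weightedMean P Q c (fun z => fderiv 𝕜 h z (P v)) x +
      weightedMean P Q (fun t => c t * t) (fun z => fderiv 𝕜 h z (Q v)) x := by
  have hd (u) := (contDiffOn_fderiv_apply hU hh u).continuousOn
  rw [(hPQ.hasFDerivAt_weightedMean hU hc hh hx).fderiv,
    ContinuousLinearMap.intervalIntegral_apply
      (intervalIntegrable_of_continuousOn_prod (hPQ.continuousOn_smul_fderiv hU hc hh) hx),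
    weightedMean, weightedMean, ← intervalIntegral.integral_add
      (intervalIntegrable_of_continuousOn_prod (hPQ.continuousOn_mul hc (hd _)) hx)
      (intervalIntegrable_of_continuousOn_prod
        (hPQ.continuousOn_mul (c := fun t => c t * t) (hc.mul RCLike.continuous_ofReal) (hd _))
        hx)]
  congr 1
  ext t
  simp only [_root_.smul_apply, _root_.add_apply, ContinuousLinearMap.comp_apply, map_add,
    map_smul, smul_eq_mul]
  ring

theorem contDiffOn_weightedMean [FiniteDimensional 𝕜 E] (hPQ : ContainsSegments P Q U)
    (hU : IsOpen U) (hc : Continuous c) (hh : ContDiffOn 𝕜 ∞ h U) :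
    ContDiffOn 𝕜 ∞ (weightedMean P Q c h) U := by
  refine contDiffOn_infty.2 fun n => ?_
  induction n generalizing c h with
  | zero =>
    exact contDiffOn_zero.2 fun x hx =>
      (hPQ.hasFDerivAt_weightedMean hU hc hh hx).continuousAt.continuousWithinAt
  | succ n ih =>
    push_cast
    rw [contDiffOn_succ_iff_fderiv_of_isOpen hU]
    refine ⟨fun x hx => (hPQ.hasFDerivAt_weightedMean hU hc hh
      hx).differentiableAt.differentiableWithinAt, by simp, contDiffOn_clm_apply.2 fun v => ?_⟩
    exact ((ih hc (contDiffOn_fderiv_apply hU hh _)).add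
      (ih (hc.mul RCLike.continuous_ofReal) (contDiffOn_fderiv_apply hU hh _))).congr
      fun x hx => hPQ.fderiv_weightedMean_apply hU hc hh hx v

/-- The left-hand side is the integral of the derivative of `t * h (P x + t • Q x)`. -/
theorem weightedMean_one_add (hPQ : ContainsSegments P Q U) (hU : IsOpen U)
    (hh : ContDiffOn 𝕜 ∞ h U) {x : E} (hx : x ∈ U) :
    weightedMean P Q (fun _ => 1) h x +
      weightedMean P Q (fun t => t) (fun z => fderiv 𝕜 h z (Q x)) x = h (P x + Q x) := by
  have hint₁ := intervalIntegrable_of_continuousOn_prod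
    (hPQ.continuousOn_mul (c := fun _ => 1) continuous_const hh.continuousOn) hx
  have hint₂ := intervalIntegrable_of_continuousOn_prod
    (hPQ.continuousOn_mul RCLike.continuous_ofReal
      (contDiffOn_fderiv_apply hU hh (Q x)).continuousOn) hx
  rw [weightedMean, weightedMean, ← intervalIntegral.integral_add hint₁ hint₂,
    intervalIntegral.integral_eq_sub_of_hasDerivAt
      (f := fun t : ℝ => (t : 𝕜) * h (P x + (t : 𝕜) • Q x)) (fun t ht => ?_) (hint₁.add hint₂)]
  · simp
  · rw [Set.uIcc_of_le zero_le_one] at ht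
    have hcast : HasDerivAt (fun t : ℝ => (t : 𝕜)) 1 t := by
      simpa using (RCLike.ofRealCLM (K := 𝕜)).hasDerivAt (x := t)
    have hline : HasDerivAt (fun a : 𝕜 => P x + a • Q x) (Q x) (t : 𝕜) := by
      simpa using ((hasDerivAt_id (t : 𝕜)).smul_const (Q x)).const_add (P x)
    have hcomp := ((hh.contDiffAt (hU.mem_nhds (hPQ t ht x hx))).differentiableAt
      (by simp)).hasFDerivAt.comp_hasDerivAt _ hline
    have hprod : HasDerivAt (fun a : 𝕜 => a * h (P x + a • Q x)) _ (t : 𝕜) :=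
      (hasDerivAt_id (t : 𝕜)).mul hcomp
    convert! HasDerivAt.scomp (𝕜 := ℝ) (𝕜' := 𝕜) t hprod hcast using 1
    simp

end ContainsSegments

theorem exists_fderiv_apply_eq_at_zero [FiniteDimensional 𝕜 E] {v : E} (hv : v ≠ 0)
    (hh : ∀ᶠ x in 𝓝 0, ContDiffAt 𝕜 ∞ h x) :
    ∃ Z : E → 𝕜, ∀ᶠ x in 𝓝 0, ContDiffAt 𝕜 ∞ Z x ∧ fderiv 𝕜 Z x v = h x := by
  obtain ⟨ℓ, hℓ⟩ := SeparatingDual.exists_eq_one (R := 𝕜) hv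
  let Q : E →L[𝕜] E := ℓ.smulRight v
  let P : E →L[𝕜] E := ContinuousLinearMap.id 𝕜 E - Q
  have hQv : Q v = v := by simp [Q, hℓ]
  have hPv : P v = 0 := by simp [P, hQv]
  obtain ⟨r, hr, hball⟩ := Metric.eventually_nhds_iff_ball.1 hh
  let U : Set E := {x | ‖P x‖ + ‖Q x‖ < r}
  have hU : IsOpen U := isOpen_lt (by fun_prop) continuous_const
  have hPQ : ContainsSegments P Q U := fun t ht x hx => by
    have hP : P (P x + (t : 𝕜) • Q x) = P x := by simp [P, Q, hℓ, mul_smul]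
    have hQ : Q (P x + (t : 𝕜) • Q x) = (t : 𝕜) • Q x := by simp [P, Q, hℓ, mul_smul]
    have ht' : ‖(t : 𝕜) • Q x‖ ≤ ‖Q x‖ := by
      rw [norm_smul, RCLike.norm_ofReal, abs_of_nonneg ht.1]
      exact mul_le_of_le_one_left (norm_nonneg _) ht.2
    simp only [U, Set.mem_ofPred_eq, hP, hQ] at hx ⊢
    linarith
  have hhU : ContDiffOn 𝕜 ∞ h U := fun x hx => by
    have hPQx : P x + Q x = x := by simp [P]
    exact (hball x (mem_ball_zero_iff.2 (hPQx ▸ (norm_add_le _ _).trans_lt hx))).contDiffWithinAt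
  have hmean := hPQ.contDiffOn_weightedMean hU (c := fun _ => 1) continuous_const hhU
  refine ⟨fun x => ℓ x * weightedMean P Q (fun _ => 1) h x, ?_⟩
  filter_upwards [hU.mem_nhds (show (0 : E) ∈ U by simpa [U] using hr)] with x hx
  have hmx := hmean.contDiffAt (hU.mem_nhds hx)
  refine ⟨ℓ.contDiff.contDiffAt.mul hmx, ?_⟩
  have hP0 : weightedMean P Q (fun _ => 1) (fun z => fderiv 𝕜 h z (P v)) x = 0 := by
    simp [hPv, weightedMean]
  have hQx : weightedMean P Q (fun t => t) (fun z => fderiv 𝕜 h z (Q x)) x =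
      ℓ x * weightedMean P Q (fun t => t) (fun z => fderiv 𝕜 h z v) x := by
    simp only [Q, ContinuousLinearMap.smulRight_apply, map_smul, smul_eq_mul,
      weightedMean_const_mul]
  have hone := hPQ.weightedMean_one_add hU hhU hx
  rw [fderiv_fun_mul ℓ.differentiableAt (hmx.differentiableAt (by simp))]
  simp only [_root_.add_apply, _root_.smul_apply, smul_eq_mul, ContinuousLinearMap.fderiv,
    hPQ.fderiv_weightedMean_apply hU continuous_const hhU hx, one_mul, hP0, hQv, hℓ]
  rw [hQx, show P x + Q x = x by simp [P]] at hone
  linear_combination hone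

theorem exists_fderiv_apply_eq [FiniteDimensional 𝕜 E] {v : E} (hv : v ≠ 0) {y₀ : E}
    (hh : ∀ᶠ y in 𝓝 y₀, ContDiffAt 𝕜 ∞ h y) :
    ∃ Z : E → 𝕜, ∀ᶠ y in 𝓝 y₀, ContDiffAt 𝕜 ∞ Z y ∧ fderiv 𝕜 Z y v = h y := by
  have hadd : Tendsto (fun x => x + y₀) (𝓝 0) (𝓝 y₀) := by
    simpa using (continuous_add_const y₀).tendsto 0
  have hsub : Tendsto (fun y => y - y₀) (𝓝 y₀) (𝓝 0) := by
    simpa using (continuous_sub_right y₀).tendsto y₀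
  obtain ⟨Z, hZ⟩ := exists_fderiv_apply_eq_at_zero (h := fun x => h (x + y₀)) hv
    ((hadd.eventually hh).mono fun x hx => hx.comp x (by fun_prop))
  refine ⟨fun y => Z (y - y₀), (hsub.eventually hZ).mono fun y hy => ⟨hy.1.comp y ?_, ?_⟩⟩
  · fun_prop
  · rw [fderiv_comp_sub, hy.2, sub_add_cancel]

end Primitives

section NormalForm

variable {𝕜 : Type*} [RCLike 𝕜] {E : Type*} [NormedAddCommGroup E] [NormedSpace 𝕜 E]

theorem dot_cross_sum_smul {R : Type*} [CommRing R] (p : Fin 3 → Fin 3 → R) (a c : Fin 3 → R)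
    (k : Fin 3) :
    p k ⬝ᵥ (∑ i, a i • p i) ⨯₃ (∑ i, c i • p i) = (a ⨯₃ c) k * (p 0 ⬝ᵥ p 1 ⨯₃ p 2) := by
  simp only [Fin.sum_univ_three, vec3_dotProduct, cross_apply, Pi.add_apply, Pi.smul_apply]
  fin_cases k <;> simp <;> ring

/-- The map `E → E` whose coefficients in the frame `b` are the functions `F i`. -/
def frameMap (b : Fin 3 → E) (F : Fin 3 → E → 𝕜) (y : E) : E :=
  ∑ i, F i y • b i

variable {F : Fin 3 → E → 𝕜} {y : E}

theorem hasFDerivAt_frameMap (b : Fin 3 → E) (hF : ∀ i, DifferentiableAt 𝕜 (F i) y) :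
    HasFDerivAt (frameMap b F) (∑ i, (fderiv 𝕜 (F i) y).smulRight (b i)) y :=
  HasFDerivAt.fun_sum fun i _ => (hF i).hasFDerivAt.smul_const (b i)

theorem grad_comp_frameMap (b : Fin 3 → E) (hF : ∀ i, DifferentiableAt 𝕜 (F i) y) {f : E → 𝕜}
    (hf : DifferentiableAt 𝕜 f (frameMap b F y)) :
    grad b (fun z => f (frameMap b F z)) y =
      ∑ i, grad b f (frameMap b F y) i • grad b (F i) y := by
  have h : fderiv 𝕜 (fun z => f (frameMap b F z)) y = _ :=
    (hf.hasFDerivAt.comp y (hasFDerivAt_frameMap b hF)).fderiv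
  ext j
  simp [grad, h, _root_.sum_apply, mul_comm]

theorem exists_hasFDerivAt_frameMap_equiv (b : Module.Basis (Fin 3) 𝕜 E)
    (hF : ∀ i, DifferentiableAt 𝕜 (F i) y)
    (h0 : grad b (F 0) y ⬝ᵥ grad b (F 1) y ⨯₃ grad b (F 2) y ≠ 0) :
    ∃ D : E ≃L[𝕜] E, HasFDerivAt (frameMap b F) (D : E →L[𝕜] E) y := by
  have := Module.Finite.of_basis b
  set D := ∑ i, (fderiv 𝕜 (F i) y).smulRight (b i) with hD
  have hdot (f : E → 𝕜) (v : E) : fderiv 𝕜 f y v = grad b f y ⬝ᵥ b.equivFun v := by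
    conv_lhs => rw [← b.sum_equivFun v, map_sum]
    simp [dotProduct, grad, mul_comm]
  have hinj : Function.Injective (D : E →ₗ[𝕜] E) := by
    refine (injective_iff_map_eq_zero _).2 fun v hv => b.equivFun.map_eq_zero_iff.1 ?_
    have hgrad (i) : grad b (F i) y ⬝ᵥ b.equivFun v = 0 := by
      have : ∑ i, fderiv 𝕜 (F i) y v • b i = 0 := by simpa [hD, _root_.sum_apply] using hv
      rw [← hdot]
      exact Fintype.linearIndependent_iff.1 b.linearIndependent _ this i
    apply (smul_eq_zero.1 (triple_product_smul_eq_add_cross (grad b (F 0) y) (grad b (F 1) y)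
      (grad b (F 2) y) (b.equivFun v) |>.trans ?_)).resolve_left h0
    simp only [hgrad, zero_smul, add_zero]
  exact ⟨(LinearEquiv.ofInjectiveEndo (D : E →ₗ[𝕜] E) hinj).toContinuousLinearEquiv,
    hasFDerivAt_frameMap b hF⟩

theorem exists_openPartialHomeomorph_frameMap
    (b : Module.Basis (Fin 3) 𝕜 E) {y₀ : E} (hF : ∀ i, ∀ᶠ y in 𝓝 y₀, ContDiffAt 𝕜 ∞ (F i) y)
    (h0 : grad b (F 0) y₀ ⬝ᵥ grad b (F 1) y₀ ⨯₃ grad b (F 2) y₀ ≠ 0)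
    {p : E → Prop} (hp : ∀ᶠ y in 𝓝 y₀, p y) :
    ∃ Φ : OpenPartialHomeomorph E E, y₀ ∈ Φ.source ∧ (∀ y ∈ Φ.source, p y) ∧
      ⇑Φ = frameMap b F ∧ ContDiffOn 𝕜 ∞ Φ Φ.source ∧ ContDiffOn 𝕜 ∞ Φ.symm Φ.target := by
  have := Module.Finite.of_basis b
  have : CompleteSpace E := FiniteDimensional.complete 𝕜 E
  have hgrad (i) : ContDiffAt 𝕜 ∞ (grad b (F i)) y₀ := contDiffAt_grad (hF i).self_of_nhds
  have hne : ∀ᶠ y in 𝓝 y₀, grad b (F 0) y ⬝ᵥ grad b (F 1) y ⨯₃ grad b (F 2) y ≠ 0 :=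
    (contDiffAt_dotProduct (hgrad 0)
      (contDiffAt_cross (hgrad 1) (hgrad 2))).continuousAt.eventually_ne h0
  obtain ⟨U, hU, hUo, hyU⟩ := eventually_nhds_iff.1 ((eventually_all.2 hF).and (hne.and hp))
  have hsmooth (y) (hy : y ∈ U) : ContDiffAt 𝕜 ∞ (frameMap b F) y :=
    ContDiffAt.sum fun i _ => ((hU y hy).1 i).smul contDiffAt_const
  have hequiv (y) (hy : y ∈ U) := exists_hasFDerivAt_frameMap_equiv b
    (fun i => ((hU y hy).1 i).differentiableAt (by simp)) (hU y hy).2.1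
  obtain ⟨D, hD⟩ := hequiv y₀ hyU
  let Φ := ((hsmooth y₀ hyU).toOpenPartialHomeomorph (frameMap b F) hD (by simp)).restrOpen U hUo
  refine ⟨Φ, ⟨(hsmooth y₀ hyU).mem_toOpenPartialHomeomorph_source hD (by simp), hyU⟩,
    fun y hy => (hU y hy.2).2.2, rfl, fun y hy => (hsmooth y hy.2).contDiffWithinAt,
    fun s hs => ?_⟩
  have hsU := (Φ.map_target hs).2
  obtain ⟨D', hD'⟩ := hequiv _ hsU
  exact (Φ.contDiffAt_symm hs hD' (hsmooth _ hsU)).contDiffWithinAt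

/-- Moving along the last coordinate of `(x, x₁, ℓ)`, for a suitable linear form `ℓ`, reduces the
equation for the third coordinate to an ordinary differential equation. -/
theorem exists_dot_grad_cross_grad_eq (b : Module.Basis (Fin 3) 𝕜 E)
    {x x₁ μ : E → 𝕜} {y₀ : E} (hx : ∀ᶠ y in 𝓝 y₀, ContDiffAt 𝕜 ∞ x y)
    (hx₁ : ∀ᶠ y in 𝓝 y₀, ContDiffAt 𝕜 ∞ x₁ y) (hμ : ∀ᶠ y in 𝓝 y₀, ContDiffAt 𝕜 ∞ μ y)
    (h0 : grad b x y₀ ⨯₃ grad b x₁ y₀ ≠ 0) :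
    ∃ z : E → 𝕜, ∀ᶠ y in 𝓝 y₀,
      ContDiffAt 𝕜 ∞ z y ∧ grad b x y ⬝ᵥ grad b x₁ y ⨯₃ grad b z y = μ y := by
  have := Module.Finite.of_basis b
  obtain ⟨k, hk⟩ := exists_dot_ne_zero h0
  let ℓ : E →L[𝕜] 𝕜 := (b.constr 𝕜 k).toContinuousLinearMap
  have hℓ (y) : grad b ℓ y = k := funext fun i => by
    rw [grad, ℓ.fderiv]
    simp [ℓ]
  let T (y : E) : 𝕜 := grad b x y ⬝ᵥ grad b x₁ y ⨯₃ k
  have hT0 : T y₀ ≠ 0 := by rwa [triple_product_permutation] at hk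
  have hT (y) (hx : ContDiffAt 𝕜 ∞ x y) (hx₁ : ContDiffAt 𝕜 ∞ x₁ y) : ContDiffAt 𝕜 ∞ T y :=
    contDiffAt_dotProduct (contDiffAt_grad hx)
      (contDiffAt_cross (contDiffAt_grad hx₁) contDiffAt_const)
  have hF (y) (hx : ContDiffAt 𝕜 ∞ x y) (hx₁ : ContDiffAt 𝕜 ∞ x₁ y) (i : Fin 3) :
      ContDiffAt 𝕜 ∞ ((![x, x₁, ℓ] : Fin 3 → E → 𝕜) i) y := by
    fin_cases i
    exacts [hx, hx₁, ℓ.contDiff.contDiffAt]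
  have hTne := (hT y₀ hx.self_of_nhds hx₁.self_of_nhds).continuousAt.eventually_ne hT0
  obtain ⟨Ψ, hyΨ, hΨp, hΨ, hΨs, hΨs'⟩ := exists_openPartialHomeomorph_frameMap b
    (F := ![x, x₁, ℓ]) (fun i => hx.mp (hx₁.mono fun y h₁ h => hF y h h₁ i))
    (by simpa [hℓ] using hT0) (hx.and (hx₁.and (hμ.and hTne)))
  have hquot : ∀ᶠ s in 𝓝 (Ψ y₀), ContDiffAt 𝕜 ∞ (fun s => μ (Ψ.symm s) / T (Ψ.symm s)) s := by
    filter_upwards [Ψ.open_target.mem_nhds (Ψ.map_source hyΨ)] with s hs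
    obtain ⟨hxs, hx₁s, hμs, hTs⟩ := hΨp _ (Ψ.map_target hs)
    exact (hμs.div (hT _ hxs hx₁s) hTs).comp s (hΨs'.contDiffAt (Ψ.open_target.mem_nhds hs))
  obtain ⟨Z, hZ⟩ := exists_fderiv_apply_eq (b.ne_zero 2) hquot
  refine ⟨fun y => Z (Ψ y), ?_⟩
  filter_upwards [Ψ.open_source.mem_nhds hyΨ, (Ψ.continuousAt hyΨ).eventually hZ] with y hy hZy
  obtain ⟨hxy, hx₁y, -, hTy⟩ := hΨp y hy
  refine ⟨hZy.1.comp y (hΨs.contDiffAt (Ψ.open_source.mem_nhds hy)), ?_⟩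
  rw [Ψ.left_inv hy] at hZy
  simp only [hΨ] at hZy ⊢
  rw [grad_comp_frameMap b (fun i => (hF y hxy hx₁y i).differentiableAt (by simp))
    (hZy.1.differentiableAt (by simp)), Fin.sum_univ_three]
  simp only [Matrix.cons_val, hℓ, map_add, map_smul, cross_self, dotProduct_add,
    dotProduct_smul, dot_cross_self, smul_zero, zero_add, dotProduct_zero]
  exact (congr($(hZy.2) * T y)).trans (div_mul_cancel₀ _ hTy)

theorem contDiff_normedSpace_exp : ContDiff 𝕜 ∞ (NormedSpace.exp : 𝕜 → 𝕜) :=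
  contDiff_iff_contDiffAt.2 fun x => (NormedSpace.exp_analytic x).contDiffAt

theorem exists_grad_eq_neg_smul (b : Fin 3 → E) {g : E → 𝕜} {y₀ : E}
    (hg : ∀ᶠ y in 𝓝 y₀, ContDiffAt 𝕜 ∞ g y) :
    ∃ u : E → 𝕜, (∀ y, u y ≠ 0) ∧
      ∀ᶠ y in 𝓝 y₀, ContDiffAt 𝕜 ∞ u y ∧ grad b u y = -u y • grad b g y := by
  refine ⟨fun y => NormedSpace.exp (-g y), fun y => (NormedSpace.isUnit_exp (-g y)).ne_zero,
    hg.mono fun y hy => ⟨contDiff_normedSpace_exp.contDiffAt.comp y hy.neg, ?_⟩⟩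
  have h : fderiv 𝕜 (fun y => NormedSpace.exp (-g y)) y = _ :=
    ((hasDerivAt_exp (𝕂 := 𝕜) (x := -g y)).comp_hasFDerivAt y
      (hy.differentiableAt (by simp)).hasFDerivAt.neg).fderiv
  ext i
  simp [grad, h]

theorem exists_smul_eq_grad (b : Module.Basis (Fin 3) 𝕜 E)
    {W L : E → Fin 3 → 𝕜} {u : E → 𝕜} {y₀ : E} (hW : ∀ᶠ y in 𝓝 y₀, ContDiffAt 𝕜 ∞ W y)
    (hu : ∀ᶠ y in 𝓝 y₀, ContDiffAt 𝕜 ∞ u y ∧ grad b u y = -u y • L y)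
    (h : ∀ᶠ y in 𝓝 y₀, curl b W y = L y ⨯₃ W y) :
    ∃ x : E → 𝕜, ∀ᶠ y in 𝓝 y₀, ContDiffAt 𝕜 ∞ x y ∧ grad b x y = u y • W y := by
  apply exists_grad_eq_of_curl_eq_zero b
  · filter_upwards [hW, hu] with y hWy huy using huy.1.smul hWy
  · filter_upwards [hW, hu, h] with y hWy huy hy
    rw [curl_smul (huy.1.differentiableAt (by simp)) (hWy.differentiableAt (by simp)), hy, huy.2]
    simp

/-- With an integrating factor `u`, that is `u • W = ∇x` and `u • W₁ = ∇x₁`, the coordinates are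
`x`, `x₁` and a function `z` with `∇x · ∇x₁ × ∇z = ρ u`. -/
theorem exists_localBracket_comp_eq (b : Module.Basis (Fin 3) 𝕜 E)
    {W W₁ L : E → Fin 3 → 𝕜} {ρ : E → 𝕜} {y₀ : E} (hW : ∀ᶠ y in 𝓝 y₀, ContDiffAt 𝕜 ∞ W y)
    (hW₁ : ∀ᶠ y in 𝓝 y₀, ContDiffAt 𝕜 ∞ W₁ y) (hL : ∀ᶠ y in 𝓝 y₀, ContDiffAt 𝕜 ∞ L y)
    (hρ : ∀ᶠ y in 𝓝 y₀, ContDiffAt 𝕜 ∞ ρ y) (hρ0 : ρ y₀ ≠ 0)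
    (hWL : ∀ᶠ y in 𝓝 y₀, curl b W y = L y ⨯₃ W y)
    (hW₁L : ∀ᶠ y in 𝓝 y₀, curl b W₁ y = L y ⨯₃ W₁ y)
    (hLc : ∀ᶠ y in 𝓝 y₀, curl b L y = 0) (h0 : W y₀ ⨯₃ W₁ y₀ ≠ 0) :
    ∃ Φ : OpenPartialHomeomorph E E, y₀ ∈ Φ.source ∧
      ContDiffOn 𝕜 ∞ Φ Φ.source ∧ ContDiffOn 𝕜 ∞ Φ.symm Φ.target ∧
      ∀ y ∈ Φ.source, ∀ α β : E →L[𝕜] 𝕜,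
        localBracket b W (α ∘ Φ) (β ∘ Φ) y = ρ y * ((α ∘ b) ⨯₃ (β ∘ b)) 0 ∧
        localBracket b W₁ (α ∘ Φ) (β ∘ Φ) y = ρ y * ((α ∘ b) ⨯₃ (β ∘ b)) 1 := by
  obtain ⟨g, hg⟩ := exists_grad_eq_of_curl_eq_zero b hL hLc
  obtain ⟨u, hu0, hu⟩ := exists_grad_eq_neg_smul b (hg.mono fun y hy => hy.1)
  have huL : ∀ᶠ y in 𝓝 y₀, ContDiffAt 𝕜 ∞ u y ∧ grad b u y = -u y • L y := by
    filter_upwards [hu, hg] with y huy hgy using ⟨huy.1, hgy.2 ▸ huy.2⟩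
  obtain ⟨x, hx⟩ := exists_smul_eq_grad b hW huL hWL
  obtain ⟨x₁, hx₁⟩ := exists_smul_eq_grad b hW₁ huL hW₁L
  obtain ⟨z, hz⟩ := exists_dot_grad_cross_grad_eq b (hx.mono fun y hy => hy.1)
    (hx₁.mono fun y hy => hy.1) (hρ.mp (hu.mono fun y huy hρy => hρy.mul huy.1))
    (by simp [hx.self_of_nhds.2, hx₁.self_of_nhds.2, hu0, h0])
  have hF : ∀ i, ∀ᶠ y in 𝓝 y₀, ContDiffAt 𝕜 ∞ ((![x, x₁, z] : Fin 3 → E → 𝕜) i) y := by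
    intro i
    fin_cases i
    exacts [hx.mono fun y hy => hy.1, hx₁.mono fun y hy => hy.1, hz.mono fun y hy => hy.1]
  obtain ⟨Φ, hyΦ, hp, hΦ, hΦs, hΦs'⟩ := exists_openPartialHomeomorph_frameMap b hF
    (hz.self_of_nhds.2.trans_ne (mul_ne_zero hρ0 (hu0 y₀)))
    ((eventually_all.2 hF).and (hx.and (hx₁.and hz)))
  refine ⟨Φ, hyΦ, hΦs, hΦs', fun y hy α β => ?_⟩
  obtain ⟨hFy, ⟨-, hxy⟩, ⟨-, hx₁y⟩, -, hzy⟩ := hp y hy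
  have hgrad (α : E →L[𝕜] 𝕜) : grad b (α ∘ Φ) y =
      ∑ i, α (b i) • grad b ((![x, x₁, z] : Fin 3 → E → 𝕜) i) y := by
    simpa only [hΦ, grad, α.fderiv, Function.comp_def] using grad_comp_frameMap (f := α) b
      (fun i => (hFy i).differentiableAt (by simp)) α.differentiableAt
  have hdot (i) := dot_cross_sum_smul (fun i => grad b ((![x, x₁, z] : Fin 3 → E → 𝕜) i) y)
    (α ∘ b) (β ∘ b) i
  constructor <;> apply mul_left_cancel₀ (hu0 y) <;>
    rw [localBracket, ← smul_eq_mul, ← smul_dotProduct, hgrad, hgrad]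
  · rw [← hxy]
    exact (hdot 0).trans (by simp only [Matrix.cons_val, hzy]; ring)
  · rw [← hx₁y]
    exact (hdot 1).trans (by simp only [Matrix.cons_val, hzy]; ring)

end NormalForm

section Charts

theorem eventually_mem_transition {X Y Z : Type*} [TopologicalSpace X] [TopologicalSpace Y]
    [TopologicalSpace Z] {e : OpenPartialHomeomorph X Y} (e' : OpenPartialHomeomorph X Z) {y : Y}
    (hy : y ∈ e.target) (hy' : e.symm y ∈ e'.source) :
    ∀ᶠ z in 𝓝 y, z ∈ e.target ∧ e.symm z ∈ e'.source :=
  (e.symm.isOpen_inter_preimage e'.open_source).mem_nhds ⟨hy, hy'⟩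

variable {𝕜 : Type*} [RCLike 𝕜] {E : Type*} [NormedAddCommGroup E] [NormedSpace 𝕜 E]
  {M : Type*} [TopologicalSpace M] [ChartedSpace E M]

section Transition

variable {e e' : OpenPartialHomeomorph M E} {y : E}

theorem mdifferentiable_of_mem_maximalAtlas (he : e ∈ IsManifold.maximalAtlas 𝓘(𝕜, E) ∞ M) :
    e.MDifferentiable 𝓘(𝕜, E) 𝓘(𝕜, E) :=
  ⟨(contMDiffOn_of_mem_maximalAtlas he).mdifferentiableOn (by simp),
    (contMDiffOn_symm_of_mem_maximalAtlas he).mdifferentiableOn (by simp)⟩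

theorem contDiffAt_transition (he : e ∈ IsManifold.maximalAtlas 𝓘(𝕜, E) ∞ M)
    (he' : e' ∈ IsManifold.maximalAtlas 𝓘(𝕜, E) ∞ M) (hy : y ∈ e.target)
    (hy' : e.symm y ∈ e'.source) : ContDiffAt 𝕜 ∞ (e' ∘ e.symm) y :=
  ((contMDiffAt_of_mem_maximalAtlas he' hy').comp y
    (contMDiffAt_symm_of_mem_maximalAtlas he hy)).contDiffAt

theorem fderiv_transition (he : e ∈ IsManifold.maximalAtlas 𝓘(𝕜, E) ∞ M)
    (he' : e' ∈ IsManifold.maximalAtlas 𝓘(𝕜, E) ∞ M) (hy : y ∈ e.target)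
    (hy' : e.symm y ∈ e'.source) :
    fderiv 𝕜 (e' ∘ e.symm) y =
      (mfderiv 𝓘(𝕜, E) 𝓘(𝕜, E) e' (e.symm y)).comp (mfderiv 𝓘(𝕜, E) 𝓘(𝕜, E) e.symm y) := by
  rw [← mfderiv_eq_fderiv]
  exact mfderiv_comp y ((mdifferentiable_of_mem_maximalAtlas he').mdifferentiableAt hy')
    ((mdifferentiable_of_mem_maximalAtlas he).mdifferentiableAt_symm hy)

end Transition

namespace DiffForm

variable {e e' : OpenPartialHomeomorph M E} {y : E} {k : ℕ} {η : DiffForm 𝕜 E M k}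

theorem inChart_eq_pullback (η : DiffForm 𝕜 E M k)
    (he : e ∈ IsManifold.maximalAtlas 𝓘(𝕜, E) ∞ M)
    (he' : e' ∈ IsManifold.maximalAtlas 𝓘(𝕜, E) ∞ M) (hy : y ∈ e.target)
    (hy' : e.symm y ∈ e'.source) :
    η.inChart e y = (η.inChart e' ((e' ∘ e.symm) y)).compContinuousLinearMap
      (fderiv 𝕜 (e' ∘ e.symm) y) := by
  have hinv (v : E) : mfderiv 𝓘(𝕜, E) 𝓘(𝕜, E) e'.symm (e' (e.symm y))
      (fderiv 𝕜 (e' ∘ e.symm) y v) = mfderiv 𝓘(𝕜, E) 𝓘(𝕜, E) e.symm y v := by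
    rw [fderiv_transition he he' hy hy']
    exact congr($((mdifferentiable_of_mem_maximalAtlas he').symm_comp_deriv hy')
      (mfderiv 𝓘(𝕜, E) 𝓘(𝕜, E) e.symm y v))
  ext v
  change η (e.symm y) _ = η (e'.symm (e' (e.symm y))) _
  rw [e'.left_inv hy']
  exact congrArg (η (e.symm y)) (funext fun i => (hinv (v i)).symm)

theorem inChart_eventuallyEq_pullback (η : DiffForm 𝕜 E M k)
    (he : e ∈ IsManifold.maximalAtlas 𝓘(𝕜, E) ∞ M)
    (he' : e' ∈ IsManifold.maximalAtlas 𝓘(𝕜, E) ∞ M) (hy : y ∈ e.target)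
    (hy' : e.symm y ∈ e'.source) :
    η.inChart e =ᶠ[𝓝 y] fun z => (η.inChart e' ((e' ∘ e.symm) z)).compContinuousLinearMap
      (fderiv 𝕜 (e' ∘ e.symm) z) :=
  (eventually_mem_transition e' hy hy').mono fun _ hz =>
    η.inChart_eq_pullback he he' hz.1 hz.2

theorem IsSmooth.contDiffAt_of_mem_atlas (hη : η.IsSmooth) (he : e ∈ atlas E M)
    (hy : y ∈ e.target) : ContDiffAt 𝕜 ∞ (η.inChart e) y :=
  (hη e he).contDiffAt (e.open_target.mem_nhds hy)

variable [IsManifold 𝓘(𝕜, E) ∞ M]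

theorem IsSmooth.differentiableAt_inChart (hη : η.IsSmooth)
    (he : e ∈ IsManifold.maximalAtlas 𝓘(𝕜, E) ∞ M) (hy : y ∈ e.target) :
    DifferentiableAt 𝕜 (η.inChart e) y := by
  have he' := IsManifold.chart_mem_maximalAtlas (I := 𝓘(𝕜, E)) (n := ∞) (e.symm y)
  have hy' := mem_chart_source E (e.symm y)
  have hτ := contDiffAt_transition he he' hy hy'
  rw [(η.inChart_eventuallyEq_pullback he he' hy hy').differentiableAt_iff]
  exact (((hη.contDiffAt_of_mem_atlas (chart_mem_atlas E _)
    ((chartAt E (e.symm y)).map_source hy')).comp y hτ).differentiableAt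
      (by simp)).continuousAlternatingMapCompContinuousLinearMap
    ((hτ.fderiv_right (m := ∞) (by simp)).differentiableAt (by simp))

theorem IsSmooth.contDiffAt_inChart_apply (hη : η.IsSmooth)
    (he : e ∈ IsManifold.maximalAtlas 𝓘(𝕜, E) ∞ M) (hy : y ∈ e.target) (v : Fin k → E) :
    ContDiffAt 𝕜 ∞ (fun z => η.inChart e z v) y := by
  have he' := IsManifold.chart_mem_maximalAtlas (I := 𝓘(𝕜, E)) (n := ∞) (e.symm y)
  have hy' := mem_chart_source E (e.symm y)
  have hτ := contDiffAt_transition he he' hy hy'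
  have hpull : (fun z => η.inChart e z v) =ᶠ[𝓝 y] fun z =>
      ContinuousAlternatingMap.toContinuousMultilinearMapCLM 𝕜
        (η.inChart (chartAt E (e.symm y)) ((chartAt E (e.symm y) ∘ e.symm) z))
        fun i => fderiv 𝕜 (chartAt E (e.symm y) ∘ e.symm) z (v i) :=
    (η.inChart_eventuallyEq_pullback he he' hy hy').mono fun z hz => congr($hz v)
  refine ContDiffAt.congr_of_eventuallyEq ?_ hpull
  exact (ContinuousLinearMap.analyticAt_uncurry_of_multilinear
    (ContinuousAlternatingMap.toContinuousMultilinearMapCLM 𝕜 :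
      (E [⋀^Fin k]→L[𝕜] 𝕜) →L[𝕜] _)).contDiffAt.comp y
    (((hη.contDiffAt_of_mem_atlas (chart_mem_atlas E _)
      ((chartAt E (e.symm y)).map_source hy')).comp y hτ).prodMk
    (contDiffAt_pi.2 fun i => (hτ.fderiv_right (m := ∞) (by simp)).clm_apply contDiffAt_const))

theorem IsSmooth.inChart_d (hη : η.IsSmooth) (he : e ∈ IsManifold.maximalAtlas 𝓘(𝕜, E) ∞ M)
    (hy : y ∈ e.target) : η.d.inChart e y = extDeriv (η.inChart e) y := by
  have he' := IsManifold.chart_mem_maximalAtlas (I := 𝓘(𝕜, E)) (n := ∞) (e.symm y)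
  have hy' := mem_chart_source E (e.symm y)
  have hη' := (hη.contDiffAt_of_mem_atlas (chart_mem_atlas E _)
    ((chartAt E (e.symm y)).map_source hy')).differentiableAt (by simp)
  rw [(η.inChart_eventuallyEq_pullback he he' hy hy').extDeriv_eq,
    extDeriv_pullback (f := chartAt E (e.symm y) ∘ e.symm) hη'
      (contDiffAt_transition he he' hy hy')
      (by simpa [minSmoothness_of_isRCLikeNormedField] using ENat.LEInfty.out),
    fderiv_transition he he' hy hy']
  rfl

end DiffForm

end Charts

section Components

variable {𝕜 : Type*} [RCLike 𝕜] {E : Type*} [NormedAddCommGroup E] [NormedSpace 𝕜 E]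
  {M : Type*} [TopologicalSpace M] [ChartedSpace E M]
  {e : OpenPartialHomeomorph M E} {y : E}

theorem exists_chart_symm_eq [IsManifold 𝓘(𝕜, E) ∞ M] (p : M) :
    ∃ e ∈ IsManifold.maximalAtlas 𝓘(𝕜, E) ∞ M, ∃ y ∈ e.target, e.symm y = p :=
  ⟨chartAt E p, IsManifold.chart_mem_maximalAtlas p, chartAt E p p, mem_chart_target E p,
    (chartAt E p).left_inv (mem_chart_source E p)⟩

/-- The vectors at `e.symm y` whose expressions in the chart `e` are the vectors `b i`. -/
noncomputable def chartFrame (b : Fin 3 → E) (e : OpenPartialHomeomorph M E) (y : E) (i : Fin 3) :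
    TangentSpace 𝓘(𝕜, E) (e.symm y) :=
  mfderiv 𝓘(𝕜, E) 𝓘(𝕜, E) e.symm y (b i)

theorem exists_basis_eq_chartFrame (b : Module.Basis (Fin 3) 𝕜 E)
    (he : e ∈ IsManifold.maximalAtlas 𝓘(𝕜, E) ∞ M) (hy : y ∈ e.target) :
    ∃ c : Module.Basis (Fin 3) 𝕜 (TangentSpace 𝓘(𝕜, E) (e.symm y)), ⇑c = chartFrame b e y := by
  let A : TangentSpace 𝓘(𝕜, E) y ≃L[𝕜] TangentSpace 𝓘(𝕜, E) (e.symm y) :=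
    (mdifferentiable_of_mem_maximalAtlas he).symm.mfderiv hy
  let b' : Module.Basis (Fin 3) 𝕜 (TangentSpace 𝓘(𝕜, E) y) := b
  exact ⟨b'.map A.toLinearEquiv, rfl⟩

theorem exists_comp_chartFrame_eq (b : Module.Basis (Fin 3) 𝕜 E)
    (he : e ∈ IsManifold.maximalAtlas 𝓘(𝕜, E) ∞ M) (hy : y ∈ e.target) (x : Fin 3 → 𝕜) :
    ∃ α : TangentSpace 𝓘(𝕜, E) (e.symm y) →L[𝕜] 𝕜, α ∘ chartFrame b e y = x := by
  have := Module.Finite.of_basis b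
  obtain ⟨c, hc⟩ := exists_basis_eq_chartFrame b he hy
  let c' : Module.Basis (Fin 3) 𝕜 E := c
  let α : E →L[𝕜] 𝕜 := (c'.constr 𝕜 x).toContinuousLinearMap
  rw [← hc]
  exact ⟨α, funext fun i => c'.constr_basis 𝕜 x i⟩

namespace DiffForm

/-- The components of a `1`-form in a chart, with respect to a frame `b` of the model space. -/
noncomputable def components (b : Fin 3 → E) (w : DiffForm 𝕜 E M 1)
    (e : OpenPartialHomeomorph M E) (y : E) (i : Fin 3) : 𝕜 :=
  w.inChart e y ![b i]

/-- The density of a `3`-form in a chart, with respect to a frame `b` of the model space. -/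
noncomputable def density (b : Fin 3 → E) (Ω : DiffForm 𝕜 E M 3)
    (e : OpenPartialHomeomorph M E) (y : E) : 𝕜 :=
  Ω.inChart e y b

theorem components_eq (b : Fin 3 → E) (w : DiffForm 𝕜 E M 1) (e : OpenPartialHomeomorph M E)
    (y : E) : w.components b e y = fun i => w (e.symm y) ![chartFrame b e y i] :=
  funext fun _ => congrArg (w (e.symm y)) (funext fun j => by fin_cases j; rfl)

theorem covector_apply (lam : DiffForm 𝕜 E M 1) (p : M) (v : TangentSpace 𝓘(𝕜, E) p) :
    lam.covector p v = lam p ![v] :=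
  congrArg (lam p) (funext fun j => by fin_cases j; rfl)

theorem covector_comp_chartFrame (b : Fin 3 → E) (lam : DiffForm 𝕜 E M 1)
    (e : OpenPartialHomeomorph M E) (y : E) :
    lam.covector (e.symm y) ∘ chartFrame b e y = lam.components b e y := by
  rw [components_eq]
  exact funext fun i => lam.covector_apply _ _

theorem axial_inChart (b : Fin 3 → E) (η : DiffForm 𝕜 E M 2) (e : OpenPartialHomeomorph M E)
    (y : E) : axial b (η.inChart e y) = axial (chartFrame b e y) (η (e.symm y)) := by
  have hpair (i j : Fin 3) : η.inChart e y ![b i, b j] =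
      η (e.symm y) ![chartFrame b e y i, chartFrame b e y j] :=
    congrArg (η (e.symm y)) (funext fun k => by fin_cases k <;> rfl)
  simp only [axial, hpair]

theorem density_ne_zero (b : Module.Basis (Fin 3) 𝕜 E) {Ω : DiffForm 𝕜 E M 3}
    (he : e ∈ IsManifold.maximalAtlas 𝓘(𝕜, E) ∞ M) (hy : y ∈ e.target)
    (hΩ0 : Ω (e.symm y) ≠ 0) : Ω.density b e y ≠ 0 := by
  obtain ⟨c, hc⟩ := exists_basis_eq_chartFrame b he hy
  refine fun h => hΩ0 (eq_of_apply_basis_eq c ?_)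
  rw [hc]
  exact h

theorem cross_components_ne_zero (b : Module.Basis (Fin 3) 𝕜 E) {w w₁ : DiffForm 𝕜 E M 1}
    (hind : LinearIndependent 𝕜 ![w (e.symm y), w₁ (e.symm y)])
    (he : e ∈ IsManifold.maximalAtlas 𝓘(𝕜, E) ∞ M) (hy : y ∈ e.target) :
    w.components b e y ⨯₃ w₁.components b e y ≠ 0 := by
  obtain ⟨c, hc⟩ := exists_basis_eq_chartFrame b he hy
  rw [LinearIndependent.pair_iff] at hind
  rw [crossProduct_ne_zero_iff_linearIndependent, LinearIndependent.pair_iff]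
  refine fun s t hst => hind s t (eq_of_apply_singleton_eq c fun i => ?_)
  rw [components_eq, components_eq, ← hc] at hst
  exact congrFun hst i

theorem components_dot_repr (b : Fin 3 → E) (w : DiffForm 𝕜 E M 1)
    {c : Module.Basis (Fin 3) 𝕜 (TangentSpace 𝓘(𝕜, E) (e.symm y))} (hc : ⇑c = chartFrame b e y)
    (v : TangentSpace 𝓘(𝕜, E) (e.symm y)) :
    w.components b e y ⬝ᵥ c.repr v = w (e.symm y) ![v] := by
  rw [← covector_apply, ← covector_comp_chartFrame, ← hc, dotProduct_comm]
  conv_rhs => rw [← c.sum_repr v, map_sum]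
  simp only [dotProduct, map_smul, smul_eq_mul, Function.comp_apply]

variable [IsManifold 𝓘(𝕜, E) ∞ M] {w lam : DiffForm 𝕜 E M 1} {Ω : DiffForm 𝕜 E M 3}

theorem IsSmooth.contDiffAt_components (hw : w.IsSmooth) (b : Fin 3 → E)
    (he : e ∈ IsManifold.maximalAtlas 𝓘(𝕜, E) ∞ M) (hy : y ∈ e.target) :
    ContDiffAt 𝕜 ∞ (w.components b e) y :=
  contDiffAt_pi.2 fun _ => hw.contDiffAt_inChart_apply he hy _

theorem IsSmooth.contDiffAt_density (hΩ : Ω.IsSmooth) (b : Fin 3 → E)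
    (he : e ∈ IsManifold.maximalAtlas 𝓘(𝕜, E) ∞ M) (hy : y ∈ e.target) :
    ContDiffAt 𝕜 ∞ (Ω.density b e) y :=
  hΩ.contDiffAt_inChart_apply he hy _

theorem IsSmooth.axial_d (hw : w.IsSmooth) (b : Fin 3 → E)
    (he : e ∈ IsManifold.maximalAtlas 𝓘(𝕜, E) ∞ M) (hy : y ∈ e.target) :
    axial (chartFrame b e y) (w.d (e.symm y)) = curl b (w.components b e) y := by
  rw [← axial_inChart, hw.inChart_d he hy, axial_extDeriv b (hw.differentiableAt_inChart he hy)]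
  rfl

theorem IsSmooth.d_eq_wedge_iff (hw : w.IsSmooth) (b : Module.Basis (Fin 3) 𝕜 E)
    (he : e ∈ IsManifold.maximalAtlas 𝓘(𝕜, E) ∞ M) (hy : y ∈ e.target)
    (α : TangentSpace 𝓘(𝕜, E) (e.symm y) →L[𝕜] 𝕜) :
    w.d (e.symm y) = wedge α (w (e.symm y)) ↔
      curl b (w.components b e) y = (α ∘ chartFrame b e y) ⨯₃ w.components b e y := by
  obtain ⟨c, hc⟩ := exists_basis_eq_chartFrame b he hy
  have hwedge : axial c (wedge α (w (e.symm y))) =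
      (α ∘ chartFrame b e y) ⨯₃ w.components b e y := by
    rw [axial_wedge, components_eq, hc]
    rfl
  rw [← hw.axial_d b he hy, ← hwedge, ← hc]
  exact ⟨fun h => congrArg _ h, eq_of_axial_eq c⟩

theorem IsSmooth.curl_components_eq_cross (hw : w.IsSmooth) (b : Module.Basis (Fin 3) 𝕜 E)
    (hd : ∀ p, w.d p = wedge (lam.covector p) (w p))
    (he : e ∈ IsManifold.maximalAtlas 𝓘(𝕜, E) ∞ M) (hy : y ∈ e.target) :
    curl b (w.components b e) y = lam.components b e y ⨯₃ w.components b e y := by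
  rw [← covector_comp_chartFrame]
  exact (hw.d_eq_wedge_iff b he hy _).1 (hd _)

theorem IsSmooth.d_eq_zero_iff (hw : w.IsSmooth) (b : Module.Basis (Fin 3) 𝕜 E)
    (he : e ∈ IsManifold.maximalAtlas 𝓘(𝕜, E) ∞ M) (hy : y ∈ e.target) :
    w.d (e.symm y) = 0 ↔ curl b (w.components b e) y = 0 := by
  obtain ⟨c, hc⟩ := exists_basis_eq_chartFrame b he hy
  have hzero : axial c (0 : TangentSpace 𝓘(𝕜, E) (e.symm y) [⋀^Fin 2]→L[𝕜] 𝕜) = 0 := by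
    simp [axial]
  rw [← hw.axial_d b he hy, ← hzero, ← hc]
  exact ⟨fun h => congrArg _ h, eq_of_axial_eq c⟩

theorem isSmooth_of_contDiffAt_components (b : Module.Basis (Fin 3) 𝕜 E)
    (h : ∀ e ∈ IsManifold.maximalAtlas 𝓘(𝕜, E) ∞ M, ∀ y ∈ e.target,
      ContDiffAt 𝕜 ∞ (w.components b e) y) : w.IsSmooth := by
  have := Module.Finite.of_basis b
  let T : (Fin 3 → 𝕜) →ₗ[𝕜] E [⋀^Fin 1]→L[𝕜] 𝕜 :=
    (ContinuousAlternatingMap.ofSubsingletonLIE (𝕜 := 𝕜) (E := E) (F := 𝕜)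
      (0 : Fin 1)).toLinearEquiv.toLinearMap ∘ₗ
        LinearMap.toContinuousLinearMap.toLinearMap ∘ₗ (b.constr 𝕜).toLinearMap
  have hT (η : E [⋀^Fin 1]→L[𝕜] 𝕜) : T (fun i => η ![b i]) = η :=
    eq_of_apply_singleton_eq b fun i => b.constr_basis 𝕜 _ i
  refine fun e he y hy => ContDiffAt.contDiffWithinAt ?_
  have hcomp := T.toContinuousLinearMap.contDiff.contDiffAt.comp y
    (h e (IsManifold.subset_maximalAtlas he) y hy)
  exact hcomp.congr_of_eventuallyEq (.of_forall fun z => (hT (w.inChart e z)).symm)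

end DiffForm

end Components

section Brackets

variable {𝕜 : Type*} [RCLike 𝕜] {E : Type*} [NormedAddCommGroup E] [NormedSpace 𝕜 E]
  {M : Type*} [TopologicalSpace M] [ChartedSpace E M]
  {e : OpenPartialHomeomorph M E} {y : E} {w w₁ : DiffForm 𝕜 E M 1} {Ω : DiffForm 𝕜 E M 3}
  {Λ Λ₁ : BivectorField 𝕜 E M} {f g : M → 𝕜}

theorem Represents.dot_cross_components (hrep : Represents w Ω Λ) (b : Fin 3 → E)
    (e : OpenPartialHomeomorph M E) (y : E) (α β : TangentSpace 𝓘(𝕜, E) (e.symm y) →L[𝕜] 𝕜) :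
    (α ∘ chartFrame b e y) ⬝ᵥ (β ∘ chartFrame b e y) ⨯₃ w.components b e y =
      Λ (e.symm y) ![α, β] * Ω.density b e y := by
  rw [DiffForm.components_eq]
  exact (wedge_wedge_apply _ α β _).symm.trans congr($(hrep (e.symm y) α β) (chartFrame b e y))

theorem rclikeMap_mul (s t : 𝕜) :
    RCLike.map 𝕜 ℂ (s * t) = RCLike.map 𝕜 ℂ s * RCLike.map 𝕜 ℂ t := by
  apply Complex.ext <;> simp [RCLike.map_apply]

theorem rclikeMap_eq_zero {s : 𝕜} : RCLike.map 𝕜 ℂ s = 0 ↔ s = 0 := by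
  simp [RCLike.map_apply, Complex.ext_iff, RCLike.ext_iff (K := 𝕜)]

theorem IsGeneric.linearIndependent (hgen : IsGeneric Λ Λ₁) (hrep : Represents w Ω Λ)
    (hrep₁ : Represents w₁ Ω Λ₁) {p : M} (hΩ0 : Ω p ≠ 0) :
    LinearIndependent 𝕜 ![w p, w₁ p] := by
  rw [LinearIndependent.pair_iff]
  intro s t hst
  by_contra hne
  obtain ⟨α, β, hαβ⟩ := hgen p (RCLike.map 𝕜 ℂ s) (RCLike.map 𝕜 ℂ t)
    (by rwa [Ne, Prod.mk.injEq, rclikeMap_eq_zero, rclikeMap_eq_zero])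
  rw [← rclikeMap_mul, ← rclikeMap_mul, ← map_add, Ne, rclikeMap_eq_zero] at hαβ
  refine smul_ne_zero hαβ hΩ0 ?_
  calc
    _ = s • Λ p ![α, β] • Ω p + t • Λ₁ p ![α, β] • Ω p := by
      ext v
      simp only [ContinuousAlternatingMap.add_apply, ContinuousAlternatingMap.smul_apply,
        smul_eq_mul, add_mul, mul_assoc]
    _ = wedge α (wedge β (s • w p + t • w₁ p)) := by
      rw [← hrep p α β, ← hrep₁ p α β]
      simp only [wedge_add, wedge_smul]
    _ = 0 := by rw [hst, wedge_zero, wedge_zero]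

theorem diff_comp_chartFrame (b : Fin 3 → E) (he : e ∈ IsManifold.maximalAtlas 𝓘(𝕜, E) ∞ M)
    (hy : y ∈ e.target) (hf : MDifferentiableAt 𝓘(𝕜, E) 𝓘(𝕜, 𝕜) f (e.symm y)) :
    diff f (e.symm y) ∘ chartFrame b e y = grad b (f ∘ e.symm) y := by
  have hcomp := mfderiv_comp y hf
    ((mdifferentiable_of_mem_maximalAtlas he).mdifferentiableAt_symm hy)
  rw [mfderiv_eq_fderiv] at hcomp
  exact funext fun i => congr($hcomp (b i)).symm

theorem Represents.localBracket_components (hrep : Represents w Ω Λ) (b : Fin 3 → E)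
    (he : e ∈ IsManifold.maximalAtlas 𝓘(𝕜, E) ∞ M) (hy : y ∈ e.target)
    (hf : MDifferentiableAt 𝓘(𝕜, E) 𝓘(𝕜, 𝕜) f (e.symm y))
    (hg : MDifferentiableAt 𝓘(𝕜, E) 𝓘(𝕜, 𝕜) g (e.symm y)) :
    localBracket b (w.components b e) (f ∘ e.symm) (g ∘ e.symm) y =
      Λ.bracket f g (e.symm y) * Ω.density b e y := by
  rw [localBracket, triple_product_permutation, ← diff_comp_chartFrame b he hy hf,
    ← diff_comp_chartFrame b he hy hg]
  exact hrep.dot_cross_components b e y _ _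

theorem diff_clm_comp_chart (he : e ∈ IsManifold.maximalAtlas 𝓘(𝕜, E) ∞ M) {p : M}
    (hp : p ∈ e.source) (α : E →L[𝕜] 𝕜) :
    diff (α ∘ e) p = α.comp (mfderiv 𝓘(𝕜, E) 𝓘(𝕜, E) e p) := by
  refine (mfderiv_comp (I' := 𝓘(𝕜, E)) p α.mdifferentiableAt
    ((mdifferentiable_of_mem_maximalAtlas he).mdifferentiableAt hp)).trans ?_
  rw [ContinuousLinearMap.mfderiv_eq]
  rfl

theorem BivectorField.inChart_apply_pair (Λ : BivectorField 𝕜 E M)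
    (he : e ∈ IsManifold.maximalAtlas 𝓘(𝕜, E) ∞ M) (hy : y ∈ e.target) (α β : E →L[𝕜] 𝕜) :
    Λ.inChart e y ![α, β] = Λ.bracket (α ∘ e) (β ∘ e) (e.symm y) := by
  rw [bracket, diff_clm_comp_chart he (e.map_target hy), diff_clm_comp_chart he (e.map_target hy)]
  exact congrArg (Λ (e.symm y)) (funext fun i => by fin_cases i <;> rfl)

end Brackets

section Jacobi

variable {𝕜 : Type*} [RCLike 𝕜] {E : Type*} [NormedAddCommGroup E] [NormedSpace 𝕜 E]
  {M : Type*} [TopologicalSpace M] [ChartedSpace E M]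
  {e : OpenPartialHomeomorph M E} {y : E} {w : DiffForm 𝕜 E M 1} {Ω : DiffForm 𝕜 E M 3}
  {Λ : BivectorField 𝕜 E M} {f g h : M → 𝕜}

theorem contDiffAt_comp_symm_iff (he : e ∈ IsManifold.maximalAtlas 𝓘(𝕜, E) ∞ M)
    (hy : y ∈ e.target) :
    ContDiffAt 𝕜 ∞ (f ∘ e.symm) y ↔ ContMDiffAt 𝓘(𝕜, E) 𝓘(𝕜, 𝕜) ∞ f (e.symm y) := by
  rw [← contMDiffWithinAt_univ,
    contMDiffWithinAt_iff_source_of_mem_maximalAtlas he (e.map_target hy)]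
  simp [e.right_inv hy, contMDiffWithinAt_iff_contDiffWithinAt, contDiffWithinAt_univ]

variable [IsManifold 𝓘(𝕜, E) ∞ M]

theorem eventually_mdifferentiableAt_symm (hy : y ∈ e.target)
    (hf : ContMDiffAt 𝓘(𝕜, E) 𝓘(𝕜, 𝕜) ∞ f (e.symm y)) :
    ∀ᶠ z in 𝓝 y, MDifferentiableAt 𝓘(𝕜, E) 𝓘(𝕜, 𝕜) f (e.symm z) := by
  have : IsManifold 𝓘(𝕜, E) 1 M := IsManifold.of_le (n := ∞) (by simp)
  have hev := (contMDiffAt_iff_contMDiffAt_nhds (n := 1) (by simp)).1 (hf.of_le (by simp))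
  filter_upwards [(e.continuousAt_symm hy).eventually hev] with z hz
  exact hz.mdifferentiableAt (by simp)

/-- The components in a chart of the vector field that corresponds to the bi-vector represented
by `w` and `Ω` under the duality between bi-vectors and vectors in dimension three given by the
frame `b`. -/
noncomputable def dualVector (b : Fin 3 → E) (w : DiffForm 𝕜 E M 1) (Ω : DiffForm 𝕜 E M 3)
    (e : OpenPartialHomeomorph M E) (y : E) : Fin 3 → 𝕜 :=
  (Ω.density b e y)⁻¹ • w.components b e y

theorem contDiffAt_dualVector (b : Module.Basis (Fin 3) 𝕜 E) (hw : w.IsSmooth) (hΩ : Ω.IsSmooth)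
    (he : e ∈ IsManifold.maximalAtlas 𝓘(𝕜, E) ∞ M) (hy : y ∈ e.target)
    (hΩ0 : Ω (e.symm y) ≠ 0) : ContDiffAt 𝕜 ∞ (dualVector b w Ω e) y :=
  ((hΩ.contDiffAt_density b he hy).inv (DiffForm.density_ne_zero b he hy hΩ0)).smul
    (hw.contDiffAt_components b he hy)

theorem dot_curl_dualVector (b : Module.Basis (Fin 3) 𝕜 E) (hw : w.IsSmooth) (hΩ : Ω.IsSmooth)
    (he : e ∈ IsManifold.maximalAtlas 𝓘(𝕜, E) ∞ M) (hy : y ∈ e.target)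
    (hΩ0 : Ω (e.symm y) ≠ 0) :
    dualVector b w Ω e y ⬝ᵥ curl b (dualVector b w Ω e) y = (Ω.density b e y)⁻¹ ^ 2 *
      (w.components b e y ⬝ᵥ curl b (w.components b e) y) :=
  dot_curl_smul (((hΩ.contDiffAt_density b he hy).inv
    (DiffForm.density_ne_zero b he hy hΩ0)).differentiableAt (by simp))
    ((hw.contDiffAt_components b he hy).differentiableAt (by simp))

theorem Represents.bracket_comp_symm_eventuallyEq (hrep : Represents w Ω Λ)
    (b : Module.Basis (Fin 3) 𝕜 E) (hΩ0 : ∀ p, Ω p ≠ 0)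
    (he : e ∈ IsManifold.maximalAtlas 𝓘(𝕜, E) ∞ M) (hy : y ∈ e.target)
    (hf : ContMDiffAt 𝓘(𝕜, E) 𝓘(𝕜, 𝕜) ∞ f (e.symm y))
    (hg : ContMDiffAt 𝓘(𝕜, E) 𝓘(𝕜, 𝕜) ∞ g (e.symm y)) :
    Λ.bracket f g ∘ e.symm =ᶠ[𝓝 y]
      localBracket b (dualVector b w Ω e) (f ∘ e.symm) (g ∘ e.symm) := by
  filter_upwards [e.open_target.mem_nhds hy, eventually_mdifferentiableAt_symm hy hf,
    eventually_mdifferentiableAt_symm hy hg] with z hz hfz hgz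
  have hbracket := hrep.localBracket_components b he hz hfz hgz
  rw [localBracket] at hbracket
  rw [localBracket, dualVector, smul_dotProduct, hbracket, smul_eq_mul, mul_comm _⁻¹]
  exact (mul_inv_cancel_right₀ (DiffForm.density_ne_zero b he hz (hΩ0 _)) _).symm

theorem Represents.bracket_bracket (hrep : Represents w Ω Λ) (b : Module.Basis (Fin 3) 𝕜 E)
    (hw : w.IsSmooth) (hΩ : Ω.IsSmooth) (hΩ0 : ∀ p, Ω p ≠ 0)
    (he : e ∈ IsManifold.maximalAtlas 𝓘(𝕜, E) ∞ M) (hy : y ∈ e.target)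
    (hf : ContMDiffAt 𝓘(𝕜, E) 𝓘(𝕜, 𝕜) ∞ f (e.symm y))
    (hg : ContMDiffAt 𝓘(𝕜, E) 𝓘(𝕜, 𝕜) ∞ g (e.symm y))
    (hh : ContMDiffAt 𝓘(𝕜, E) 𝓘(𝕜, 𝕜) ∞ h (e.symm y)) :
    Λ.bracket f (Λ.bracket g h) (e.symm y) = localBracket b (dualVector b w Ω e) (f ∘ e.symm)
      (localBracket b (dualVector b w Ω e) (g ∘ e.symm) (h ∘ e.symm)) y := by
  have hinner := hrep.bracket_comp_symm_eventuallyEq b hΩ0 he hy hg hh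
  have hsmooth : ContMDiffAt 𝓘(𝕜, E) 𝓘(𝕜, 𝕜) ∞ (Λ.bracket g h) (e.symm y) := by
    rw [← contDiffAt_comp_symm_iff he hy] at hg hh ⊢
    exact (contDiffAt_localBracket (contDiffAt_dualVector b hw hΩ he hy (hΩ0 _))
      hg hh).congr_of_eventuallyEq hinner
  exact (hrep.bracket_comp_symm_eventuallyEq b hΩ0 he hy hf hsmooth).self_of_nhds.trans
    (localBracket_congr .rfl hinner)

theorem Represents.jacobi_sum_eq (hrep : Represents w Ω Λ) (b : Module.Basis (Fin 3) 𝕜 E)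
    (hw : w.IsSmooth) (hΩ : Ω.IsSmooth) (hΩ0 : ∀ p, Ω p ≠ 0)
    (he : e ∈ IsManifold.maximalAtlas 𝓘(𝕜, E) ∞ M) (hy : y ∈ e.target)
    (hf : ContMDiffAt 𝓘(𝕜, E) 𝓘(𝕜, 𝕜) ∞ f (e.symm y))
    (hg : ContMDiffAt 𝓘(𝕜, E) 𝓘(𝕜, 𝕜) ∞ g (e.symm y))
    (hh : ContMDiffAt 𝓘(𝕜, E) 𝓘(𝕜, 𝕜) ∞ h (e.symm y)) :
    Λ.bracket f (Λ.bracket g h) (e.symm y) + Λ.bracket g (Λ.bracket h f) (e.symm y) +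
      Λ.bracket h (Λ.bracket f g) (e.symm y) =
    -((Ω.density b e y)⁻¹ ^ 2 * (w.components b e y ⬝ᵥ curl b (w.components b e) y) *
      (grad b (f ∘ e.symm) y ⬝ᵥ grad b (g ∘ e.symm) y ⨯₃ grad b (h ∘ e.symm) y)) := by
  rw [hrep.bracket_bracket b hw hΩ hΩ0 he hy hf hg hh,
    hrep.bracket_bracket b hw hΩ hΩ0 he hy hg hh hf,
    hrep.bracket_bracket b hw hΩ hΩ0 he hy hh hf hg,
    ← dot_curl_dualVector b hw hΩ he hy (hΩ0 _)]
  rw [← contDiffAt_comp_symm_iff he hy] at hf hg hh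
  exact localBracket_jacobi (contDiffAt_dualVector b hw hΩ he hy (hΩ0 _)) hf hg hh

theorem Represents.dot_curl_eq_zero (hrep : Represents w Ω Λ)
    (b : Module.Basis (Fin 3) 𝕜 E) (hw : w.IsSmooth) (hΩ : Ω.IsSmooth) (hΩ0 : ∀ p, Ω p ≠ 0)
    {U : Set M} (hU : IsOpen U) (hΛ : Λ.IsPoissonOn U)
    (he : e ∈ IsManifold.maximalAtlas 𝓘(𝕜, E) ∞ M) (hy : y ∈ e.target) (hyU : e.symm y ∈ U) :
    w.components b e y ⬝ᵥ curl b (w.components b e) y = 0 := by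
  have := Module.Finite.of_basis b
  have hV : IsOpen (U ∩ e.source) := hU.inter e.open_source
  have hyV : e.symm y ∈ U ∩ e.source := ⟨hyU, e.map_target hy⟩
  have hx (i : Fin 3) : ContMDiffOn 𝓘(𝕜, E) 𝓘(𝕜, 𝕜) ∞ (b.coord i ∘ e) (U ∩ e.source) :=
    (b.coord i).toContinuousLinearMap.contMDiff.comp_contMDiffOn
      ((contMDiffOn_of_mem_maximalAtlas he).mono Set.inter_subset_right)
  have hgrad (i : Fin 3) : grad b ((b.coord i ∘ e) ∘ e.symm) y = Pi.single i 1 :=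
    grad_eq_single_of_eventuallyEq_coord <| by
      filter_upwards [e.open_target.mem_nhds hy] with z hz
      simp only [Function.comp_apply, e.right_inv hz]
  have hx' (i : Fin 3) := (hx i).contMDiffAt (hV.mem_nhds hyV)
  have hjacobi := hrep.jacobi_sum_eq b hw hΩ hΩ0 he hy (hx' 0) (hx' 1) (hx' 2)
  rw [hΛ.2 _ hV Set.inter_subset_left _ _ _ (hx 0) (hx 1) (hx 2) _ hyV, hgrad, hgrad,
    hgrad] at hjacobi
  simpa [DiffForm.density_ne_zero b he hy (hΩ0 _), vec3_dotProduct, cross_apply] using hjacobi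

theorem Represents.isPoissonOn (hrep : Represents w Ω Λ) (b : Module.Basis (Fin 3) 𝕜 E)
    (hw : w.IsSmooth) (hΩ : Ω.IsSmooth) (hΩ0 : ∀ p, Ω p ≠ 0) {U : Set M} (hΛ : Λ.IsSmoothOn U)
    (h0 : ∀ e ∈ IsManifold.maximalAtlas 𝓘(𝕜, E) ∞ M, ∀ y ∈ e.target,
      w.components b e y ⬝ᵥ curl b (w.components b e) y = 0) :
    Λ.IsPoissonOn U := by
  refine ⟨hΛ, fun V hV _ f g h hf hg hh p hp => ?_⟩
  obtain ⟨e, he, y, hy, rfl⟩ := exists_chart_symm_eq (𝕜 := 𝕜) (E := E) p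
  have hnhds := hV.mem_nhds hp
  rw [hrep.jacobi_sum_eq b hw hΩ hΩ0 he hy (hf.contMDiffAt hnhds) (hg.contMDiffAt hnhds)
    (hh.contMDiffAt hnhds), h0 e he y hy, mul_zero, zero_mul, neg_zero]

end Jacobi

section PoissonPairs

variable {𝕜 : Type*} [RCLike 𝕜] {E : Type*} [NormedAddCommGroup E] [NormedSpace 𝕜 E]
  {M : Type*} [TopologicalSpace M] [ChartedSpace E M]
  {w w₁ lam : DiffForm 𝕜 E M 1} {Ω : DiffForm 𝕜 E M 3} {Λ Λ₁ : BivectorField 𝕜 E M} {p : M}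

theorem Represents.add (hrep : Represents w Ω Λ) (hrep₁ : Represents w₁ Ω Λ₁) :
    Represents (fun p => w p + w₁ p) Ω (fun p => Λ p + Λ₁ p) := fun p α β => by
  rw [wedge_add, wedge_add, hrep p α β, hrep₁ p α β]
  exact (add_smul _ _ _).symm

theorem DiffForm.IsSmooth.add (hw : w.IsSmooth) (hw₁ : w₁.IsSmooth) :
    DiffForm.IsSmooth (fun p => w p + w₁ p) := fun e he =>
  (hw e he).add (hw₁ e he)

theorem BivectorField.IsSmoothOn.add {U : Set M} (hΛ : Λ.IsSmoothOn U) (hΛ₁ : Λ₁.IsSmoothOn U) :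
    BivectorField.IsSmoothOn (fun p => Λ p + Λ₁ p) U := fun e he =>
  (hΛ e he).add (hΛ₁ e he)

theorem DiffForm.wedge_covector_self (w : DiffForm 𝕜 E M 1) (p : M) :
    wedge (w.covector p) (w p) = 0 := by
  refine eq_of_apply_pair_eq fun u v => ?_
  rw [wedge_apply_pair, covector_apply, covector_apply, mul_comm, sub_self]
  rfl

theorem Represents.apply_eq_zero_of_mem_im (hrep : Represents w Ω Λ) (hΩ0 : Ω p ≠ 0)
    {v : TangentSpace 𝓘(𝕜, E) p} (hv : v ∈ Λ.im p) : w p ![v] = 0 := by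
  obtain ⟨α, hα⟩ := hv
  have hzero : Λ p ![α, w.covector p] • Ω p = 0 := by
    rw [← hrep p, w.wedge_covector_self, wedge_zero]
  rw [← w.covector_apply, hα]
  exact (smul_eq_zero.1 hzero).resolve_right hΩ0

variable [IsManifold 𝓘(𝕜, E) ∞ M]

theorem Represents.isPoissonOn_of_d_eq_wedge (hrep : Represents w Ω Λ)
    (b : Module.Basis (Fin 3) 𝕜 E) (hw : w.IsSmooth) (hΩ : Ω.IsSmooth) (hΩ0 : ∀ p, Ω p ≠ 0)
    {U : Set M} (hΛ : Λ.IsSmoothOn U) (h : ∀ p, w.d p = wedge (lam.covector p) (w p)) :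
    Λ.IsPoissonOn U := by
  refine hrep.isPoissonOn b hw hΩ hΩ0 hΛ fun e he y hy => ?_
  rw [hw.curl_components_eq_cross b h he hy, dot_cross_self]

theorem DiffForm.IsSmooth.d_add (hw : w.IsSmooth) (hw₁ : w₁.IsSmooth) :
    DiffForm.d (fun p => w p + w₁ p) = fun p => w.d p + w₁.d p := by
  funext p
  have hdiff {v : DiffForm 𝕜 E M 1} (hv : v.IsSmooth) :=
    hv.differentiableAt_inChart (IsManifold.chart_mem_maximalAtlas p) (mem_chart_target E p)
  exact congr(($(extDeriv_add (hdiff hw) (hdiff hw₁))).compContinuousLinearMap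
    (mfderiv 𝓘(𝕜, E) 𝓘(𝕜, E) (chartAt E p) p))

theorem isPoissonPair_of_d_eq_wedge (b : Module.Basis (Fin 3) 𝕜 E)
    (hΛ : Λ.IsSmoothOn Set.univ) (hΛ₁ : Λ₁.IsSmoothOn Set.univ) (hw : w.IsSmooth)
    (hw₁ : w₁.IsSmooth) (hΩ : Ω.IsSmooth) (hΩ0 : ∀ p, Ω p ≠ 0) (hrep : Represents w Ω Λ)
    (hrep₁ : Represents w₁ Ω Λ₁) (h : ∀ p, w.d p = wedge (lam.covector p) (w p))
    (h₁ : ∀ p, w₁.d p = wedge (lam.covector p) (w₁ p)) : IsPoissonPair Λ Λ₁ :=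
  fun _ => ⟨Set.univ, isOpen_univ, trivial, hrep.isPoissonOn_of_d_eq_wedge b hw hΩ hΩ0 hΛ h,
    hrep₁.isPoissonOn_of_d_eq_wedge b hw₁ hΩ hΩ0 hΛ₁ h₁,
    (hrep.add hrep₁).isPoissonOn_of_d_eq_wedge b (hw.add hw₁) hΩ hΩ0 (hΛ.add hΛ₁)
      fun p => by rw [hw.d_add hw₁, wedge_add, ← h, ← h₁]⟩

/-- Polarising the integrability conditions of `w`, `w₁` and `w + w₁` gives the compatibility
condition of the linear system `x ⨯ W = curl W`, `x ⨯ W₁ = curl W₁`. -/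
theorem exists_d_eq_wedge_at (b : Module.Basis (Fin 3) 𝕜 E)
    (hpair : IsPoissonPair Λ Λ₁) (hw : w.IsSmooth) (hw₁ : w₁.IsSmooth) (hΩ : Ω.IsSmooth)
    (hΩ0 : ∀ p, Ω p ≠ 0) (hrep : Represents w Ω Λ) (hrep₁ : Represents w₁ Ω Λ₁)
    (hind : LinearIndependent 𝕜 ![w p, w₁ p]) :
    ∃ α : TangentSpace 𝓘(𝕜, E) p →L[𝕜] 𝕜, w.d p = wedge α (w p) ∧ w₁.d p = wedge α (w₁ p) := by
  obtain ⟨e, he, y, hy, rfl⟩ := exists_chart_symm_eq (𝕜 := 𝕜) (E := E) p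
  obtain ⟨U, hU, hyU, hΛ, hΛ₁, hsum⟩ := hpair (e.symm y)
  have h := hrep.dot_curl_eq_zero b hw hΩ hΩ0 hU hΛ he hy hyU
  have h₁ := hrep₁.dot_curl_eq_zero b hw₁ hΩ hΩ0 hU hΛ₁ he hy hyU
  have hsum0 : (w.components b e y + w₁.components b e y) ⬝ᵥ
      (curl b (w.components b e) y + curl b (w₁.components b e) y) = 0 := by
    rw [← curl_add ((hw.contDiffAt_components b he hy).differentiableAt (by simp))
      ((hw₁.contDiffAt_components b he hy).differentiableAt (by simp))]
    exact (hrep.add hrep₁).dot_curl_eq_zero b (hw.add hw₁) hΩ hΩ0 hU hsum he hy hyU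
  obtain ⟨x, hx, hx₁⟩ := exists_cross_eq (DiffForm.cross_components_ne_zero b hind he hy) h h₁
    (by simpa [h, h₁, dotProduct_add, add_dotProduct, add_comm] using hsum0)
  obtain ⟨α, rfl⟩ := exists_comp_chartFrame_eq b he hy x
  exact ⟨α, (hw.d_eq_wedge_iff b he hy α).2 hx.symm, (hw₁.d_eq_wedge_iff b he hy α).2 hx₁.symm⟩

theorem DiffForm.isSmooth_of_d_eq_wedge (b : Module.Basis (Fin 3) 𝕜 E)
    (hw : w.IsSmooth) (hw₁ : w₁.IsSmooth) (hind : ∀ p, LinearIndependent 𝕜 ![w p, w₁ p])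
    (h : ∀ p, w.d p = wedge (lam.covector p) (w p))
    (h₁ : ∀ p, w₁.d p = wedge (lam.covector p) (w₁ p)) : lam.IsSmooth := by
  refine isSmooth_of_contDiffAt_components b fun e he y hy => ?_
  obtain ⟨k, hk⟩ := exists_dot_ne_zero (cross_components_ne_zero b (hind (e.symm y)) he hy)
  have hW := hw.contDiffAt_components b he hy
  have hW₁ := hw₁.contDiffAt_components b he hy
  have hden : ContDiffAt 𝕜 ∞ (fun z => k ⬝ᵥ w.components b e z ⨯₃ w₁.components b e z) y :=
    contDiffAt_dotProduct contDiffAt_const (contDiffAt_cross hW hW₁)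
  have hnum := contDiffAt_crossSolution hW hW₁ (contDiffAt_curl hW (b := b))
    (contDiffAt_curl hW₁ (b := b)) k
  refine ((hden.inv hk).smul hnum).congr_of_eventuallyEq ?_
  filter_upwards [e.open_target.mem_nhds hy, hden.continuousAt.eventually_ne hk] with z hz hz0
  exact (eq_inv_smul_iff₀ hz0).2 (smul_eq_crossSolution
    (hw.curl_components_eq_cross b h he hz).symm (hw₁.curl_components_eq_cross b h₁ he hz).symm k)

theorem exists_isSmooth_d_eq_wedge (b : Module.Basis (Fin 3) 𝕜 E)
    (hpair : IsPoissonPair Λ Λ₁) (hw : w.IsSmooth) (hw₁ : w₁.IsSmooth) (hΩ : Ω.IsSmooth)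
    (hΩ0 : ∀ p, Ω p ≠ 0) (hrep : Represents w Ω Λ) (hrep₁ : Represents w₁ Ω Λ₁)
    (hind : ∀ p, LinearIndependent 𝕜 ![w p, w₁ p]) :
    ∃ lam : DiffForm 𝕜 E M 1, lam.IsSmooth ∧
      (∀ p, w.d p = wedge (lam.covector p) (w p)) ∧
      (∀ p, w₁.d p = wedge (lam.covector p) (w₁ p)) := by
  choose α hα hα₁ using fun p =>
    exists_d_eq_wedge_at b hpair hw hw₁ hΩ hΩ0 hrep hrep₁ (hind p)
  let lam : DiffForm 𝕜 E M 1 := fun p => ContinuousAlternatingMap.ofSubsingleton 𝕜 _ 𝕜 0 (α p)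
  have hlam (p : M) : lam.covector p = α p := Equiv.symm_apply_apply _ _
  simp only [← hlam] at hα hα₁
  exact ⟨lam, DiffForm.isSmooth_of_d_eq_wedge b hw hw₁ hind hα hα₁, hα, hα₁⟩

theorem DiffForm.IsSmooth.curl_components_eq_smul_cross (hlam : lam.IsSmooth)
    (b : Module.Basis (Fin 3) 𝕜 E) (hw : w.IsSmooth) (hw₁ : w₁.IsSmooth)
    (h : ∀ p, w.d p = wedge (lam.covector p) (w p))
    (h₁ : ∀ p, w₁.d p = wedge (lam.covector p) (w₁ p))
    {e : OpenPartialHomeomorph M E} (he : e ∈ IsManifold.maximalAtlas 𝓘(𝕜, E) ∞ M) {y : E}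
    (hy : y ∈ e.target) (hind : LinearIndependent 𝕜 ![w (e.symm y), w₁ (e.symm y)]) :
    ∃ s : 𝕜, curl b (lam.components b e) y =
      s • w.components b e y ⨯₃ w₁.components b e y := by
  have horth {v : DiffForm 𝕜 E M 1} (hv : v.IsSmooth)
      (hd : ∀ p, v.d p = wedge (lam.covector p) (v p)) :
      v.components b e y ⬝ᵥ curl b (lam.components b e) y = 0 := by
    refine dot_curl_eq_zero_of_curl_eq_cross (hv.contDiffAt_components b he hy)
      ((hlam.contDiffAt_components b he hy).differentiableAt (by simp)) ?_
    filter_upwards [e.open_target.mem_nhds hy] with z hz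
    exact hv.curl_components_eq_cross b hd he hz
  exact exists_eq_smul_cross (cross_components_ne_zero b hind he hy) (horth hw h) (horth hw₁ h₁)

theorem DiffForm.IsSmooth.d_apply_pair_eq_zero (hlam : lam.IsSmooth)
    (b : Module.Basis (Fin 3) 𝕜 E) (hw : w.IsSmooth) (hw₁ : w₁.IsSmooth)
    (h : ∀ p, w.d p = wedge (lam.covector p) (w p))
    (h₁ : ∀ p, w₁.d p = wedge (lam.covector p) (w₁ p))
    (hind : LinearIndependent 𝕜 ![w p, w₁ p]) {v : TangentSpace 𝓘(𝕜, E) p}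
    (hv : w p ![v] = 0) (hv₁ : w₁ p ![v] = 0) (u : TangentSpace 𝓘(𝕜, E) p) :
    lam.d p ![v, u] = 0 := by
  obtain ⟨e, he, y, hy, rfl⟩ := exists_chart_symm_eq (𝕜 := 𝕜) (E := E) p
  obtain ⟨s, hs⟩ := hlam.curl_components_eq_smul_cross b hw hw₁ h h₁ he hy hind
  obtain ⟨c, hc⟩ := exists_basis_eq_chartFrame b he hy
  obtain ⟨t, ht⟩ := exists_eq_smul_cross (cross_components_ne_zero b hind he hy)
    ((w.components_dot_repr b hc v).trans hv) ((w₁.components_dot_repr b hc v).trans hv₁)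
  rw [← c.sum_repr v, ← c.sum_repr u, apply_sum_smul, hc, hlam.axial_d b he hy, hs, ht]
  simp [dot_self_cross]

end PoissonPairs

section Flat

variable {𝕜 : Type*} [RCLike 𝕜] {E : Type*} [NormedAddCommGroup E] [NormedSpace 𝕜 E]
  {M : Type*} [TopologicalSpace M] [ChartedSpace E M]
  {e : OpenPartialHomeomorph M E} {w w₁ lam : DiffForm 𝕜 E M 1} {Ω : DiffForm 𝕜 E M 3}
  {Λ Λ₁ : BivectorField 𝕜 E M}

theorem Represents.components_dot_comp_cross_comp (hrep : Represents w Ω Λ) (b : Fin 3 → E)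
    (he : e ∈ IsManifold.maximalAtlas 𝓘(𝕜, E) ∞ M) {y : E} (hy : y ∈ e.target)
    (α β : E →L[𝕜] 𝕜) :
    w.components b e y ⬝ᵥ (α ∘ b) ⨯₃ (β ∘ b) = Λ.inChart e y ![α, β] * Ω.density b e y := by
  have hdiff (γ : E →L[𝕜] 𝕜) : diff (γ ∘ e) (e.symm y) ∘ chartFrame b e y = γ ∘ b := by
    rw [diff_clm_comp_chart he (e.map_target hy)]
    exact funext fun i => congrArg γ
      congr($((mdifferentiable_of_mem_maximalAtlas he).comp_symm_deriv hy) (b i))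
  rw [triple_product_permutation, Λ.inChart_apply_pair he hy, ← hdiff α, ← hdiff β]
  exact hrep.dot_cross_components b e y _ _

/-- The vector `k` collects the coefficients of `c` in the basis dual to `b`. -/
theorem Represents.exists_components_eq_density_smul (hrep : Represents w Ω Λ)
    (b : Module.Basis (Fin 3) 𝕜 E) (he : e ∈ IsManifold.maximalAtlas 𝓘(𝕜, E) ∞ M)
    {c : (E →L[𝕜] 𝕜) [⋀^Fin 2]→L[𝕜] 𝕜} (hc : ∀ y ∈ e.target, Λ.inChart e y = c) :
    ∃ k : Fin 3 → 𝕜, ∀ y ∈ e.target, w.components b e y = Ω.density b e y • k := by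
  have := Module.Finite.of_basis b
  let x (i : Fin 3) : E →L[𝕜] 𝕜 := (b.coord i).toContinuousLinearMap
  have hx (i j : Fin 3) : x i (b j) = if j = i then 1 else 0 := by
    simp [x, Finsupp.single_apply]
  refine ⟨![c ![x 1, x 2], c ![x 2, x 0], c ![x 0, x 1]], fun y hy => ?_⟩
  have hdot (i j : Fin 3) := hc y hy ▸ hrep.components_dot_comp_cross_comp b he hy (x i) (x j)
  ext i
  fin_cases i
  · simpa [cross_apply, dotProduct, Fin.sum_univ_three, hx, mul_comm] using hdot 1 2
  · simpa [cross_apply, dotProduct, Fin.sum_univ_three, hx, mul_comm] using hdot 2 0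
  · simpa [cross_apply, dotProduct, Fin.sum_univ_three, hx, mul_comm] using hdot 0 1

theorem smul_cross_eq_grad_cross {b : Fin 3 → E} {W L : E → Fin 3 → 𝕜} {ρ : E → 𝕜} {k : Fin 3 → 𝕜}
    {y : E} (hρ : DifferentiableAt 𝕜 ρ y) (hW : W =ᶠ[𝓝 y] fun z => ρ z • k)
    (hcurl : curl b W y = L y ⨯₃ W y) : (ρ y • L y) ⨯₃ k = grad b ρ y ⨯₃ k := by
  have hconst : curl b (fun _ => k) y = 0 := by simp [curl]
  rw [curl_congr hW, curl_smul hρ (differentiableAt_const k), hconst, smul_zero, zero_add,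
    hW.self_of_nhds] at hcurl
  rw [hcurl, map_smul, map_smul, LinearMap.smul_apply]

theorem Represents.inChart_trans_mul_density (hrep : Represents w Ω Λ) (b : Fin 3 → E)
    (he : e ∈ IsManifold.maximalAtlas 𝓘(𝕜, E) ∞ M) {Φ : OpenPartialHomeomorph E E}
    (hΦ : e.trans Φ ∈ IsManifold.maximalAtlas 𝓘(𝕜, E) ∞ M) {y : E} (hy : y ∈ (e.trans Φ).target)
    (α β : E →L[𝕜] 𝕜) :
    Λ.inChart (e.trans Φ) y ![α, β] * Ω.density b e (Φ.symm y) =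
      localBracket b (w.components b e) (α ∘ Φ) (β ∘ Φ) (Φ.symm y) := by
  obtain ⟨-, hye⟩ := e.trans_target Φ ▸ hy
  have hcomp (γ : E →L[𝕜] 𝕜) : (γ ∘ e.trans Φ) ∘ e.symm =ᶠ[𝓝 (Φ.symm y)] γ ∘ Φ := by
    filter_upwards [e.open_target.mem_nhds hye] with z hz
    simp [e.right_inv hz]
  have hdiff (γ : E →L[𝕜] 𝕜) :
      MDifferentiableAt 𝓘(𝕜, E) 𝓘(𝕜, 𝕜) (γ ∘ e.trans Φ) (e.symm (Φ.symm y)) :=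
    γ.mdifferentiableAt.comp _ ((mdifferentiable_of_mem_maximalAtlas hΦ).mdifferentiableAt
      ((e.trans Φ).map_target hy))
  rw [Λ.inChart_apply_pair hΦ hy, ← localBracket_congr (hcomp α) (hcomp β)]
  exact (hrep.localBracket_components b he hye (hdiff α) (hdiff β)).symm

variable [IsManifold 𝓘(𝕜, E) ∞ M]

/-- In flat coordinates `W = ρ k` and `W₁ = ρ k₁` with `k`, `k₁` constant, so `lam` is the
logarithmic differential of the density `ρ`. -/
theorem d_eq_zero_of_isFlat (b : Module.Basis (Fin 3) 𝕜 E) (hw : w.IsSmooth) (hw₁ : w₁.IsSmooth)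
    (hΩ : Ω.IsSmooth) (hΩ0 : ∀ p, Ω p ≠ 0) (hrep : Represents w Ω Λ) (hrep₁ : Represents w₁ Ω Λ₁)
    (hind : ∀ p, LinearIndependent 𝕜 ![w p, w₁ p]) (hlam : lam.IsSmooth)
    (h : ∀ p, w.d p = wedge (lam.covector p) (w p))
    (h₁ : ∀ p, w₁.d p = wedge (lam.covector p) (w₁ p)) (hflat : IsFlat Λ Λ₁) (p : M) :
    lam.d p = 0 := by
  obtain ⟨e, he, hp, c, c₁, hc⟩ := hflat p
  obtain ⟨k, hk⟩ := hrep.exists_components_eq_density_smul b he fun y hy => (hc y hy).1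
  obtain ⟨k₁, hk₁⟩ := hrep₁.exists_components_eq_density_smul b he fun y hy => (hc y hy).2
  have hρ {y : E} (hy : y ∈ e.target) := hΩ.contDiffAt_density b he hy
  have hgrad {y : E} (hy : y ∈ e.target) :
      grad b (Ω.density b e) y = Ω.density b e y • lam.components b e y := by
    have hne := DiffForm.cross_components_ne_zero b (hind (e.symm y)) he hy
    have hkk₁ : k ⨯₃ k₁ ≠ 0 := fun h0 => hne <| by
      rw [hk y hy, hk₁ y hy, map_smul, map_smul, LinearMap.smul_apply, h0, smul_zero, smul_zero]
    have hmem := e.open_target.mem_nhds hy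
    exact (eq_of_cross_eq_cross hkk₁
      (smul_cross_eq_grad_cross ((hρ hy).differentiableAt (by simp))
        (eventually_of_mem hmem hk) (hw.curl_components_eq_cross b h he hy))
      (smul_cross_eq_grad_cross ((hρ hy).differentiableAt (by simp))
        (eventually_of_mem hmem hk₁) (hw₁.curl_components_eq_cross b h₁ he hy))).symm
  have hy := e.map_source hp
  rw [← e.left_inv hp, hlam.d_eq_zero_iff b he hy]
  exact curl_eq_zero_of_smul_eq_grad (hρ hy) (DiffForm.density_ne_zero b he hy (hΩ0 _))
    ((hlam.contDiffAt_components b he hy).differentiableAt (by simp))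
    (eventually_of_mem (e.open_target.mem_nhds hy) fun z hz => hgrad hz)

theorem trans_mem_maximalAtlas (he : e ∈ IsManifold.maximalAtlas 𝓘(𝕜, E) ∞ M)
    {Φ : OpenPartialHomeomorph E E} (hΦ : ContDiffOn 𝕜 ∞ Φ Φ.source)
    (hΦs : ContDiffOn 𝕜 ∞ Φ.symm Φ.target) :
    e.trans Φ ∈ IsManifold.maximalAtlas 𝓘(𝕜, E) ∞ M := by
  apply OpenPartialHomeomorph.mem_maximalAtlas_of_contMDiffOn
  · rw [OpenPartialHomeomorph.coe_trans, OpenPartialHomeomorph.trans_source]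
    exact hΦ.contMDiffOn.comp ((contMDiffOn_of_mem_maximalAtlas he).mono Set.inter_subset_left)
      fun q hq => hq.2
  · rw [OpenPartialHomeomorph.coe_trans_symm, OpenPartialHomeomorph.trans_target]
    exact (contMDiffOn_symm_of_mem_maximalAtlas he).comp
      (hΦs.contMDiffOn.mono Set.inter_subset_left) fun q hq => hq.2

theorem isFlat_of_d_eq_zero (b : Module.Basis (Fin 3) 𝕜 E) (hw : w.IsSmooth) (hw₁ : w₁.IsSmooth)
    (hΩ : Ω.IsSmooth) (hΩ0 : ∀ p, Ω p ≠ 0) (hrep : Represents w Ω Λ) (hrep₁ : Represents w₁ Ω Λ₁)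
    (hind : ∀ p, LinearIndependent 𝕜 ![w p, w₁ p]) (hlam : lam.IsSmooth)
    (h : ∀ p, w.d p = wedge (lam.covector p) (w p))
    (h₁ : ∀ p, w₁.d p = wedge (lam.covector p) (w₁ p)) (hd : ∀ p, lam.d p = 0) :
    IsFlat Λ Λ₁ := by
  have := Module.Finite.of_basis b
  intro p
  obtain ⟨e, he, y₀, hy₀, rfl⟩ := exists_chart_symm_eq (𝕜 := 𝕜) (E := E) p
  have hev {P : E → Prop} (hP : ∀ y ∈ e.target, P y) : ∀ᶠ y in 𝓝 y₀, P y :=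
    eventually_of_mem (e.open_target.mem_nhds hy₀) hP
  have hρ0 {y : E} (hy : y ∈ e.target) := DiffForm.density_ne_zero b he hy (hΩ0 (e.symm y))
  obtain ⟨Φ, hyΦ, hΦ, hΦs, hbracket⟩ := exists_localBracket_comp_eq b
    (hev fun y hy => hw.contDiffAt_components b he hy)
    (hev fun y hy => hw₁.contDiffAt_components b he hy)
    (hev fun y hy => hlam.contDiffAt_components b he hy)
    (hev fun y hy => hΩ.contDiffAt_density b he hy) (hρ0 hy₀)
    (hev fun y hy => hw.curl_components_eq_cross b h he hy)
    (hev fun y hy => hw₁.curl_components_eq_cross b h₁ he hy)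
    (hev fun y hy => (hlam.d_eq_zero_iff b he hy).1 (hd _))
    (DiffForm.cross_components_ne_zero b (hind _) he hy₀)
  have heΦ := trans_mem_maximalAtlas he hΦ hΦs
  have hconst {y : E} (hy : y ∈ (e.trans Φ).target) (α β : E →L[𝕜] 𝕜) :
      Λ.inChart (e.trans Φ) y ![α, β] = ((α ∘ b) ⨯₃ (β ∘ b)) 0 ∧
        Λ₁.inChart (e.trans Φ) y ![α, β] = ((α ∘ b) ⨯₃ (β ∘ b)) 1 := by
    obtain ⟨hyt, hye⟩ := e.trans_target Φ ▸ hy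
    obtain ⟨hα, hα₁⟩ := hbracket _ (Φ.map_target hyt) α β
    rw [← hrep.inChart_trans_mul_density b he heΦ hy, mul_comm] at hα
    rw [← hrep₁.inChart_trans_mul_density b he heΦ hy, mul_comm] at hα₁
    exact ⟨mul_left_cancel₀ (hρ0 hye) hα, mul_left_cancel₀ (hρ0 hye) hα₁⟩
  have hp : e.symm y₀ ∈ (e.trans Φ).source := by
    simpa [OpenPartialHomeomorph.trans_source, e.map_target hy₀, e.right_inv hy₀] using hyΦ
  have hp' := (e.trans Φ).map_source hp
  exact ⟨e.trans Φ, heΦ, hp, Λ.inChart (e.trans Φ) _, Λ₁.inChart (e.trans Φ) _, fun y hy =>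
    ⟨eq_of_apply_pair_eq fun α β => (hconst hy α β).1.trans (hconst hp' α β).1.symm,
      eq_of_apply_pair_eq fun α β => (hconst hy α β).2.trans (hconst hp' α β).2.symm⟩⟩

end Flat

end BiHam

open BiHam in
theorem proposition2_general {𝕜 : Type*} [RCLike 𝕜]
    {E : Type*} [NormedAddCommGroup E] [NormedSpace 𝕜 E] (hE : Module.finrank 𝕜 E = 3)
    {M : Type*} [TopologicalSpace M] [ChartedSpace E M] [IsManifold 𝓘(𝕜, E) ∞ M]
    (Λ Λ₁ : BivectorField 𝕜 E M) (hΛ : Λ.IsSmoothOn Set.univ)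
    (hΛ₁ : Λ₁.IsSmoothOn Set.univ)
    (hgen : IsGeneric Λ Λ₁)
    (w w₁ : DiffForm 𝕜 E M 1) (Ω : DiffForm 𝕜 E M 3)
    (hw : w.IsSmooth) (hw₁ : w₁.IsSmooth) (hΩ : Ω.IsSmooth) (hΩ0 : ∀ p, Ω p ≠ 0)
    (hrep : Represents w Ω Λ) (hrep₁ : Represents w₁ Ω Λ₁) :
    ((∃ lam : DiffForm 𝕜 E M 1, lam.IsSmooth ∧
        (∀ p, w.d p = wedge (lam.covector p) (w p)) ∧
        (∀ p, w₁.d p = wedge (lam.covector p) (w₁ p))) ↔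
      IsPoissonPair Λ Λ₁) ∧
    ∀ lam : DiffForm 𝕜 E M 1, lam.IsSmooth →
      (∀ p, w.d p = wedge (lam.covector p) (w p)) →
      (∀ p, w₁.d p = wedge (lam.covector p) (w₁ p)) →
      (∀ p, Λ.im p ∩ Λ₁.im p ⊆ lam.d.ker p) ∧
      ((∀ p, lam.d p = 0) ↔ IsFlat Λ Λ₁) := by
  have : FiniteDimensional 𝕜 E := FiniteDimensional.of_finrank_pos (by omega)
  let b : Module.Basis (Fin 3) 𝕜 E := Module.finBasisOfFinrankEq 𝕜 E hE
  have hind (p : M) : LinearIndependent 𝕜 ![w p, w₁ p] :=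
    hgen.linearIndependent hrep hrep₁ (hΩ0 p)
  refine ⟨⟨fun ⟨lam, _, h, h₁⟩ =>
    isPoissonPair_of_d_eq_wedge b hΛ hΛ₁ hw hw₁ hΩ hΩ0 hrep hrep₁ h h₁, fun hpair =>
    exists_isSmooth_d_eq_wedge b hpair hw hw₁ hΩ hΩ0 hrep hrep₁ hind⟩,
    fun lam hlam h h₁ => ⟨fun p v ⟨hv, hv₁⟩ u => ?_, ?_, ?_⟩⟩
  · exact hlam.d_apply_pair_eq_zero b hw hw₁ h h₁ (hind p)
      (hrep.apply_eq_zero_of_mem_im (hΩ0 p) hv) (hrep₁.apply_eq_zero_of_mem_im (hΩ0 p) hv₁) u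
  · exact isFlat_of_d_eq_zero b hw hw₁ hΩ hΩ0 hrep hrep₁ hind hlam h h₁
  · exact d_eq_zero_of_isFlat b hw hw₁ hΩ hΩ0 hrep hrep₁ hind hlam h h₁

open BiHam in
theorem proposition2 {𝕜 : Type*} [RCLike 𝕜]
    {E : Type*} [NormedAddCommGroup E] [NormedSpace 𝕜 E] (hE : Module.finrank 𝕜 E = 3)
    {M : Type*} [TopologicalSpace M] [ChartedSpace E M] [IsManifold 𝓘(𝕜, E) ∞ M]
    (Λ Λ₁ : BivectorField 𝕜 E M) (hΛ : Λ.IsPoisson) (hΛ₁ : Λ₁.IsPoisson)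
    (hgen : IsGeneric Λ Λ₁)
    (w w₁ : DiffForm 𝕜 E M 1) (Ω : DiffForm 𝕜 E M 3)
    (hw : w.IsSmooth) (hw₁ : w₁.IsSmooth) (hΩ : Ω.IsSmooth) (hΩ0 : ∀ p, Ω p ≠ 0)
    (hrep : Represents w Ω Λ) (hrep₁ : Represents w₁ Ω Λ₁) :
    ((∃ lam : DiffForm 𝕜 E M 1, lam.IsSmooth ∧
        (∀ p, w.d p = wedge (lam.covector p) (w p)) ∧
        (∀ p, w₁.d p = wedge (lam.covector p) (w₁ p))) ↔
      IsPoissonPair Λ Λ₁) ∧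
    ∀ lam : DiffForm 𝕜 E M 1, lam.IsSmooth →
      (∀ p, w.d p = wedge (lam.covector p) (w p)) →
      (∀ p, w₁.d p = wedge (lam.covector p) (w₁ p)) →
      (∀ p, Λ.im p ∩ Λ₁.im p ⊆ lam.d.ker p) ∧
      ((∀ p, lam.d p = 0) ↔ IsFlat Λ Λ₁) :=
  proposition2_general hE Λ Λ₁ hΛ.1 hΛ₁.1 hgen w w₁ Ω hw hw₁ hΩ hΩ0 hrep hrep₁
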